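/- Throughout, rings are associative with unit, not necessarily commutative, and "countable" means finite or countably infinite. For a countable first-order language $L$ let $\mathrm{Str}_L$ be the space of all $L$-structures with universe $\mathbb{N}$, with its natural topology, generated by the sets of structures in which a given function symbol takes a given value at a given tuple, or a given relation symbol holds (respectively fails) at a given tuple. For a first-order theory or $L_{\omega_1,\omega}$-sentence $T$ in $L$, let $\mathrm{Mod}(T)\subseteq \mathrm{Str}_L$ be the set of its models with universe $\mathbb{N}$. For $T$ in $L$ and $S$ in a countable language $L'$, write $T\le_B S$ if there is a Borel map $f:\mathrm{Mod}(T)\to\mathrm{Mod}(S)$ such that for all $M,N\in \mathrm{Mod}(T)$, $f(M)\cong f(N)$ if and only if $M\cong N$. Call $S$ Borel complete if it is maximal for $\le_B$, that is, $T\le_B S$ for every $L_{\omega_1,\omega}$-sentence $T$ in every countable language $L$. **Theorem.** Let $R$ be a countable ring and let $x,y\in R$ be central elements such that 1. $(x)\cap(y)=0$; and 2. the two-sided ideal $I=\mathrm{Ann}(x)+\mathrm{Ann}(y)$ is proper, i.e. $1\notin I$. Then the theory of left $R$-modules, in the language $\{+,0\}\cup\{r\cdot : r\in R\}$, is Borel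 complete. -/

import Mathlib

universe u v u' v'

namespace BorelComplexity

open FirstOrder FirstOrder.Language

/-! ### Countable structures, Borel reducibility -/

/-- The space of all `L`-structures with universe `ℕ`. -/
abbrev Str (L : FirstOrder.Language.{u, v}) : Type (max u v) := L.Structure ℕ

/-- The natural topology on the space of `L`-structures with universe `ℕ`: it is generated by the
sets of structures in which a given function symbol takes a given value at a given tuple, and the
sets of structures in which a given relation symbol holds (or fails) at a given tuple. -/
instance instTopologicalSpaceStr (L : FirstOrder.Language.{u, v}) : TopologicalSpace (Str L) :=
  TopologicalSpace.generateFrom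
    ({U | ∃ (n : ℕ) (f : L.Functions n) (a : Fin n → ℕ) (b : ℕ), U = {M : Str L | M.funMap f a = b}} ∪
     {U | ∃ (n : ℕ) (r : L.Relations n) (a : Fin n → ℕ), U = {M : Str L | M.RelMap r a}} ∪
     {U | ∃ (n : ℕ) (r : L.Relations n) (a : Fin n → ℕ), U = {M : Str L | ¬ M.RelMap r a}})

/-- The Borel sets of the space of `L`-structures with universe `ℕ`. -/
instance instMeasurableSpaceStr (L : FirstOrder.Language.{u, v}) : MeasurableSpace (Str L) :=
  borel (Str L)

instance instBorelSpaceStr (L : FirstOrder.Language.{u, v}) : BorelSpace (Str L) := ⟨rfl⟩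

/-- Isomorphism of `L`-structures with universe `ℕ`. -/
def Iso {L : FirstOrder.Language.{u, v}} (M N : Str L) : Prop :=
  Nonempty (@FirstOrder.Language.Equiv L ℕ ℕ M N)

/-- Formulas of the infinitary logic `L_{ω₁,ω}` with free variables among `n` given ones:
countable conjunctions and finite strings of quantifiers are allowed. -/
inductive InfFormula (L : FirstOrder.Language.{u, v}) : ℕ → Type (max u v)
  | equal {n : ℕ} (s t : L.Term (Fin n)) : InfFormula L n
  | rel {n l : ℕ} (r : L.Relations l) (ts : Fin l → L.Term (Fin n)) : InfFormula L n
  | not {n : ℕ} (φ : InfFormula L n) : InfFormula L n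
  | conj {n : ℕ} (φ : ℕ → InfFormula L n) : InfFormula L n
  | all {n : ℕ} (φ : InfFormula L (n + 1)) : InfFormula L n

/-- Satisfaction of an `L_{ω₁,ω}`-formula in a structure under an assignment. -/
def InfFormula.Realize {L : FirstOrder.Language.{u, v}} (A : Type*) [L.Structure A] :
    {n : ℕ} → InfFormula L n → (Fin n → A) → Prop
  | _, .equal s t, w => s.realize w = t.realize w
  | _, .rel r ts, w => Structure.RelMap r (fun i => (ts i).realize w)
  | _, .not φ, w => ¬ φ.Realize A w
  | _, .conj φ, w => ∀ k, (φ k).Realize A w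
  | _, .all φ, w => ∀ a : A, φ.Realize A (Fin.snoc w a)

/-- `Mod(ψ)`: the models with universe `ℕ` of an `L_{ω₁,ω}`-sentence `ψ`. -/
def InfModels {L : FirstOrder.Language.{u, v}} (ψ : InfFormula L 0) : Set (Str L) :=
  {M | @InfFormula.Realize L ℕ M 0 ψ Fin.elim0}

/-- `Mod(T)`: the models with universe `ℕ` of a first-order theory `T`. -/
def Models {L : FirstOrder.Language.{u, v}} (T : L.Theory) : Set (Str L) :=
  {M | @Theory.Model L ℕ M T}

/-- Borel reducibility of classes of countable structures: there is a Borel map `f` between the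
classes with `f(M) ≅ f(N)` if and only if `M ≅ N`. -/
def BorelReducible {L : FirstOrder.Language.{u, v}} {L' : FirstOrder.Language.{u', v'}}
    (C : Set (Str L)) (D : Set (Str L')) : Prop :=
  ∃ f : C → D, Measurable f ∧ ∀ M N : C, Iso (f M).1 (f N).1 ↔ Iso M.1 N.1

/-- A class of countable structures is Borel complete if it is maximal for Borel reducibility:
the class of models of every `L_{ω₁,ω}`-sentence in every countable language reduces to it.
(Up to renaming of symbols, every countable language lives in the lowest universe.) -/
def BorelComplete {L : FirstOrder.Language.{u, v}} (D : Set (Str L)) : Prop :=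
  ∀ (L' : FirstOrder.Language.{0, 0}), Countable L'.Symbols →
    ∀ ψ : InfFormula L' 0, BorelReducible (InfModels ψ) D

/-! ### The theory of left modules -/

/-- Function symbols `0`, `+`, and one unary symbol for multiplication by each scalar. -/
inductive ModuleFunc (R : Type u) : ℕ → Type u
  | zero : ModuleFunc R 0
  | smul (r : R) : ModuleFunc R 1
  | add : ModuleFunc R 2

/-- The language of left `R`-modules. -/
def moduleLanguage (R : Type u) : FirstOrder.Language.{u, 0} := ⟨ModuleFunc R, fun _ => Empty⟩

section

variable {R : Type u} {α : Type}

/-- The term `0`. -/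
def zeroT : (moduleLanguage R).Term α :=
  Constants.term (L := moduleLanguage R) ModuleFunc.zero

/-- The term `s + t`. -/
def addT (s t : (moduleLanguage R).Term α) : (moduleLanguage R).Term α :=
  Functions.apply₂ (L := moduleLanguage R) ModuleFunc.add s t

/-- The term `r t`. -/
def smulT (r : R) (t : (moduleLanguage R).Term α) : (moduleLanguage R).Term α :=
  Functions.apply₁ (L := moduleLanguage R) (ModuleFunc.smul r) t

end

/-- The first-order theory of left `R`-modules: the axioms of abelian groups, and
`r(a + b) = ra + rb`, `(r + s)a = ra + sa`, `(rs)a = r(sa)`, `1a = a`. -/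
inductive moduleTheory (R : Type u) [Ring R] : (moduleLanguage R).Theory
  | add_assoc : moduleTheory R
      (∀' ∀' ∀' (addT (addT (&0) (&1)) (&2) =' addT (&0) (addT (&1) (&2))))
  | add_comm : moduleTheory R (∀' ∀' (addT (&0) (&1) =' addT (&1) (&0)))
  | add_zero : moduleTheory R (∀' (addT (&0) zeroT =' &0))
  | exists_neg : moduleTheory R (∀' ∃' (addT (&0) (&1) =' zeroT))
  | smul_add (r : R) : moduleTheory R
      (∀' ∀' (smulT r (addT (&0) (&1)) =' addT (smulT r (&0)) (smulT r (&1))))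
  | add_smul (r s : R) : moduleTheory R
      (∀' (smulT (r + s) (&0) =' addT (smulT r (&0)) (smulT s (&0))))
  | mul_smul (r s : R) : moduleTheory R
      (∀' (smulT (r * s) (&0) =' smulT r (smulT s (&0))))
  | one_smul : moduleTheory R (∀' (smulT (1 : R) (&0) =' &0))

end BorelComplexity

/-! Choose a maximal left ideal J containing Ann(x) + Ann(y), and put N = R/J and F = R/(Jx + Jy).
Since (x) ∩ (y) = 0, an equation xv = yw in F forces v and w to vanish in the simple module N, while
y kills the kernel of F → N (`exists_independentPair`). The same holds for direct sums over any
basis B. If an endomorphism t of F^(B) induces s on N^(B), divide F^(B) by all xv - y·tv. In the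
quotient the kernel of y is exactly the kernel of the map to N^(B), and the solutions w of xv = yw
give back s. So the quotient determines s up to conjugacy (`IndependentPair.exists_commute`), and
conjugate t give isomorphic quotients (`nonempty_equiv_of_commute`).

It remains to code a structure on ℕ by one endomorphism of some N^(B). Countably many partial
functions on a countable set are used first. The danger is that a linear isomorphism commuting with
them need not permute the basis. Rigidity comes from copies of a group Γ with two unique products,
acted on by right translations: a commuting isomorphism is a unit of a group ring over a division
ring, hence a trivial unit (`exists_eq_single_of_commute_mulRight`). Monomiality then passes along
the orbit map from Γ to copies of ℕ, from these to points separated by their evaluations in ℕ, and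
from points to their coordinates (`exists_perm_of_commute`). Conversely every isomorphism of
structures must lift to the basis. This is a back-and-forth argument that needs Γ to be highly
transitive on ℕ (`Pt.exists_lift`). Such a Γ is found acting on a dense coloured linear order, which
makes it left orderable.

The partial functions are finally merged into a single endomorphism, which acts as multiplication by
a variable X on a module of power series. For each partial function f and basis element v there is a
lacunary series with terms at exponents 3^s, whose coefficients are infinitely often v and
infinitely often f(v). Comparing coefficients at 3^s recovers the action of f
(`exists_commute_of_commute_shift`). -/

open Function

/-! ### Back-and-forth through generic ideals -/

section BackAndForth

/-- A back-and-forth system between two countable types, meeting countably many further cofinal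
sets, yields a bijection. -/
theorem exists_equiv_of_backAndForth {S α β : Type*} [Preorder S] [Countable α] [Countable β]
    (s₀ : S) (G : S → Set (α × β)) (hG : Monotone G)
    (forth : ∀ s a, ∃ s', s ≤ s' ∧ ∃ b, (a, b) ∈ G s')
    (back : ∀ s b, ∃ s', s ≤ s' ∧ ∃ a, (a, b) ∈ G s')
    (inj : ∀ s a a' b b', (a, b) ∈ G s → (a', b') ∈ G s → (a = a' ↔ b = b'))
    (D : ℕ → Set S) (hD : ∀ n s, ∃ s', s ≤ s' ∧ s' ∈ D n) :
    ∃ (e : α ≃ β) (I : Order.Ideal S), (∀ a, ∃ s ∈ I, (a, e a) ∈ G s) ∧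
      ∀ n, ∃ s ∈ I, s ∈ D n := by
  classical
  let _ := Encodable.ofCountable α
  let _ := Encodable.ofCountable β
  let 𝒟 : (α ⊕ β) ⊕ ℕ → Order.Cofinal S := fun x => match x with
    | .inl (.inl a) => ⟨{s | ∃ b, (a, b) ∈ G s}, fun s => by
        obtain ⟨s', h, h'⟩ := forth s a; exact ⟨s', h', h⟩⟩
    | .inl (.inr b) => ⟨{s | ∃ a, (a, b) ∈ G s}, fun s => by
        obtain ⟨s', h, h'⟩ := back s b; exact ⟨s', h', h⟩⟩
    | .inr n => ⟨D n, fun s => by obtain ⟨s', h, h'⟩ := hD n s; exact ⟨s', h', h⟩⟩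
  let I := Order.idealOfCofinals s₀ 𝒟
  have hI : ∀ i, ∃ s, s ∈ 𝒟 i ∧ s ∈ I := Order.cofinal_meets_idealOfCofinals s₀ 𝒟
  have h1 : ∀ a, ∃ b, ∃ s ∈ I, (a, b) ∈ G s := fun a => by
    obtain ⟨s, ⟨b, hb⟩, hs⟩ := hI (.inl (.inl a)); exact ⟨b, s, hs, hb⟩
  have h2 : ∀ b, ∃ a, ∃ s ∈ I, (a, b) ∈ G s := fun b => by
    obtain ⟨s, ⟨a, ha⟩, hs⟩ := hI (.inl (.inr b)); exact ⟨a, s, hs, ha⟩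
  choose f hf using h1
  choose g hg using h2
  have key : ∀ a a' b b', (∃ s ∈ I, (a, b) ∈ G s) → (∃ s ∈ I, (a', b') ∈ G s) →
      (a = a' ↔ b = b') := by
    rintro a a' b b' ⟨s, hs, h⟩ ⟨s', hs', h'⟩
    obtain ⟨t, -, ht, ht'⟩ := I.directed s hs s' hs'
    exact inj t a a' b b' (hG ht h) (hG ht' h')
  refine ⟨⟨f, g, fun a => ?_, fun b => ?_⟩, I, hf, fun n => ?_⟩
  · exact (key _ _ _ _ (hg (f a)) (hf a)).2 rfl
  · exact (key _ _ _ _ (hf (g b)) (hg b)).1 rfl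
  · obtain ⟨s, h, hs⟩ := hI (.inr n); exact ⟨s, hs, h⟩

end BackAndForth

/-! ### A left-orderable highly transitive group -/

section OrderedGroup

/-- Comparing automorphisms lexicographically along an enumeration of `L` gives a left-invariant
linear order: composing on the left with an increasing bijection preserves both the first place of
difference and the inequality there. -/
theorem twoUniqueProds_orderIso (L : Type*) [LinearOrder L] [Countable L] [Nonempty L] :
    TwoUniqueProds (L ≃o L) := by
  obtain ⟨q, hq⟩ := exists_surjective_nat L
  let F : (L ≃o L) → Lex (ℕ → L) := fun g => toLex fun n => g (q n)
  have hF : Injective F := fun g h e => by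
    ext x
    obtain ⟨n, rfl⟩ := hq x
    exact congrFun e n
  let _ : LinearOrder (L ≃o L) := LinearOrder.lift' F hF
  have : MulLeftStrictMono (L ≃o L) := ⟨fun f g h hgh => by
    obtain ⟨i, hi, hlt⟩ := (hgh : F g < F h)
    exact (⟨i, fun j hj => congrArg f (hi j hj), f.strictMono hlt⟩ : F (f * g) < F (f * h))⟩
  infer_instance

variable {L : Type*} [LinearOrder L] {c : L → ℕ}

/-- Every colour is dense, also near the ends. -/
def DenseColors (c : L → ℕ) : Prop :=
  ∀ lo hi : Finset L, (∀ x ∈ lo, ∀ y ∈ hi, x < y) → ∀ k, ∃ z, c z = k ∧ (∀ x ∈ lo, x < z) ∧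
    ∀ y ∈ hi, z < y

/-- The one-point extension step: the required `b` must lie in the cut that `T` assigns to `a`, and
each colour occurs in every such cut. -/
theorem DenseColors.extend (hc : DenseColors c) (T : Finset (L × L))
    (hT : ∀ p ∈ T, ∀ q ∈ T, p.1 < q.1 ↔ p.2 < q.2) (a : L) (k : ℕ) (ha : ∀ p ∈ T, p.1 ≠ a) :
    ∃ b, c b = k ∧ ∀ p ∈ T, (p.1 < a ↔ p.2 < b) ∧ (a < p.1 ↔ b < p.2) := by
  classical
  obtain ⟨b, hb, h1, h2⟩ := hc ((T.filter fun p => p.1 < a).image Prod.snd)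
    ((T.filter fun p => a < p.1).image Prod.snd) (by
      simp only [Finset.mem_image, Finset.mem_filter]
      rintro _ ⟨p, ⟨hp, hpa⟩, rfl⟩ _ ⟨q, ⟨hq, hqa⟩, rfl⟩
      exact (hT p hp q hq).1 (hpa.trans hqa)) k
  simp only [Finset.mem_image, Finset.mem_filter, forall_exists_index, and_imp] at h1 h2
  refine ⟨b, hb, fun p hp => ?_⟩
  rcases lt_or_gt_of_ne (ha p hp) with h | h
  · have := h1 _ p hp h rfl
    simp [h, this, h.not_gt, this.not_gt]
  · have := h2 _ p hp h rfl
    simp [h, this, h.not_gt, this.not_gt]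

/-- Every permutation of the colours is induced by an order automorphism. -/
theorem DenseColors.exists_orderIso [Countable L] (hc : DenseColors c) (π : Equiv.Perm ℕ) :
    ∃ g : L ≃o L, ∀ x, c (g x) = π (c x) := by
  classical
  let S := {T : Finset (L × L) // (∀ p ∈ T, ∀ q ∈ T, p.1 < q.1 ↔ p.2 < q.2) ∧
    ∀ p ∈ T, c p.2 = π (c p.1)}
  have hins : ∀ (T : S) (a b : L), c b = π (c a) →
      (∀ p ∈ T.1, (p.1 < a ↔ p.2 < b) ∧ (a < p.1 ↔ b < p.2)) →
      ∃ T' : S, T ≤ T' ∧ (a, b) ∈ (T'.1 : Set (L × L)) := by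
    intro T a b hab h
    refine ⟨⟨insert (a, b) T.1, ⟨?_, ?_⟩⟩, Finset.subset_insert _ _, by simp⟩
    · intro p hp q hq
      rcases Finset.mem_insert.1 hp with rfl | hp <;> rcases Finset.mem_insert.1 hq with rfl | hq
      · simp
      · exact (h q hq).2
      · exact (h p hp).1
      · exact T.2.1 p hp q hq
    · intro p hp
      rcases Finset.mem_insert.1 hp with rfl | hp
      · exact hab
      · exact T.2.2 p hp
  have heq : ∀ (T : S) (a a' b b' : L), (a, b) ∈ T.1 → (a', b') ∈ T.1 → (a = a' ↔ b = b') := by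
    intro T a a' b b' h h'
    have h1 := T.2.1 _ h _ h'
    have h2 := T.2.1 _ h' _ h
    simp only at h1 h2
    rw [eq_iff_le_not_lt, eq_iff_le_not_lt, ← not_lt, ← not_lt, h1, h2]
  obtain ⟨e, I, he, -⟩ := exists_equiv_of_backAndForth (S := S) (α := L) (β := L)
    ⟨∅, by simp, by simp⟩ (fun T => (T.1 : Set (L × L))) (fun T T' h => h)
    (fun T a => by
      by_cases h : ∃ b, (a, b) ∈ T.1
      · exact ⟨T, le_rfl, h⟩
      · obtain ⟨b, hb, h'⟩ := hc.extend T.1 T.2.1 a (π (c a)) (by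
          rintro ⟨x, y⟩ hp rfl; exact h ⟨y, hp⟩)
        obtain ⟨T', h1, h2⟩ := hins T a b hb h'
        exact ⟨T', h1, b, h2⟩)
    (fun T b => by
      by_cases h : ∃ a, (a, b) ∈ T.1
      · exact ⟨T, le_rfl, h⟩
      · obtain ⟨a, ha, h'⟩ := hc.extend (T.1.image Prod.swap) (by
          simp only [Finset.mem_image]
          rintro _ ⟨p, hp, rfl⟩ _ ⟨q, hq, rfl⟩
          exact (T.2.1 p hp q hq).symm) b (π.symm (c b)) (by
            simp only [Finset.mem_image]
            rintro _ ⟨p, hp, rfl⟩ rfl; exact h ⟨p.1, hp⟩)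
        obtain ⟨T', h1, h2⟩ := hins T a b (by simp [ha]) (fun p hp => by
          have := h' p.swap (Finset.mem_image_of_mem _ hp)
          exact ⟨this.1.symm, this.2.symm⟩)
        exact ⟨T', h1, a, h2⟩)
    heq (fun _ => Set.univ) (fun _ s => ⟨s, le_rfl, trivial⟩)
  refine ⟨⟨e, fun {a b} => ?_⟩, fun x => ?_⟩
  · obtain ⟨s, hs, h⟩ := he a
    obtain ⟨t, ht, h'⟩ := he b
    obtain ⟨T, -, h1, h2⟩ := I.directed s hs t ht
    have := T.2.1 _ (h2 h') _ (h1 h)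
    simp only at this
    rw [← not_lt, ← not_lt, this]
  · obtain ⟨s, hs, h⟩ := he x
    exact s.2.2 _ h

/-- Pairs `(q, k)`, ordered as the real numbers `q + k √2`. -/
@[ext]
structure ColoredRat where
  rat : ℚ
  color : ℕ

namespace ColoredRat

noncomputable def toReal (x : ColoredRat) : ℝ := (x.rat : ℝ) + x.color * √2

theorem toReal_injective : Injective toReal := by
  rintro ⟨q, k⟩ ⟨q', k'⟩ h
  simp only [toReal] at h
  by_cases hk : k = k'
  · subst hk
    congr
    simpa using h
  · exfalso
    have hk' : ((k : ℝ) - k') ≠ 0 := sub_ne_zero.2 (by exact_mod_cast hk)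
    refine irrational_sqrt_two ⟨(q' - q) / (k - k'), ?_⟩
    push_cast
    rw [div_eq_iff hk']
    linarith

noncomputable instance : LinearOrder ColoredRat := LinearOrder.lift' toReal toReal_injective

instance : Countable ColoredRat :=
  Injective.countable (f := fun x : ColoredRat => (x.rat, x.color)) fun _ _ h => by
    simpa [ColoredRat.ext_iff] using h

instance : Nonempty ColoredRat := ⟨⟨0, 0⟩⟩

/-- The elements of colour `k` form the translate of ℚ by `k √2`, which is dense in ℝ. -/
theorem denseColors : DenseColors color := by
  classical
  intro lo hi h k
  obtain ⟨m₁, h1, h2⟩ := Order.exists_between_finsets (lo.image toReal) (hi.image toReal) (by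
    simp only [Finset.mem_image]
    rintro _ ⟨x, hx, rfl⟩ _ ⟨y, hy, rfl⟩
    exact h x hx y hy)
  obtain ⟨m₂, h3, h4⟩ := Order.exists_between_finsets {m₁} (hi.image toReal) (by simpa using h2)
  obtain ⟨q, hq, hq'⟩ := exists_rat_btwn (sub_lt_sub_right (h3 m₁ (by simp)) (k * √2))
  refine ⟨⟨q, k⟩, rfl, fun x hx => ?_, fun y hy => ?_⟩
  · have := h1 _ (Finset.mem_image_of_mem _ hx)
    change toReal x < q + k * √2
    linarith
  · have := h4 _ (Finset.mem_image_of_mem _ hy)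
    change q + k * √2 < toReal y
    linarith

end ColoredRat

/-- There is a countable group with two unique products acting highly transitively on `ℕ`. -/
theorem exists_twoUniqueProds_highlyTransitive :
    ∃ (Γ : Type) (_ : Group Γ) (_ : MulAction Γ ℕ), Countable Γ ∧ TwoUniqueProds Γ ∧
      ∀ n (u v : Fin n ↪ ℕ), ∃ γ : Γ, ∀ i, γ • u i = v i := by
  have hperm : ∀ t : (Σ n, (Fin n ↪ ℕ) × (Fin n ↪ ℕ)), ∃ π : Equiv.Perm ℕ,
      ∀ i, π (t.2.1 i) = t.2.2 i := fun t => by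
    obtain ⟨π, h⟩ := (Equiv.Perm.isMultiplyPretransitive ℕ t.1).exists_smul_eq t.2.1 t.2.2
    exact ⟨π, fun i => DFunLike.congr_fun h i⟩
  choose π hπ using hperm
  choose g hg using fun t => ColoredRat.denseColors.exists_orderIso (π t)
  -- Each generator acts at once on the order and on the colours, compatibly; Γ will be the image of
  -- this homomorphism.
  let α : FreeGroup (Σ n, (Fin n ↪ ℕ) × (Fin n ↪ ℕ)) →* (ColoredRat ≃o ColoredRat) × Equiv.Perm ℕ :=
    FreeGroup.lift fun t => (g t, π t)
  have hα : ∀ w x, ((α w).1 x).color = (α w).2 x.color := by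
    intro w
    induction w using FreeGroup.induction_on with
    | C1 => intro x; simp
    | of t => intro x; simpa [α] using hg t x
    | inv_of t ih =>
      intro x
      have := ih ((α (FreeGroup.of t))⁻¹.1 x)
      rw [map_inv]
      simp only [Prod.fst_inv, Prod.snd_inv] at this ⊢
      rw [Equiv.Perm.eq_inv_iff_eq, ← this]
      simp
    | mul a b ha hb => intro x; simp [ha, hb]
  have hcount : Countable (Σ n, (Fin n ↪ ℕ) × (Fin n ↪ ℕ)) := by
    have : ∀ n, Countable (Fin n ↪ ℕ) := fun n => DFunLike.coe_injective.countable
    infer_instance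
  let f : α.range →* (ColoredRat ≃o ColoredRat) := (MonoidHom.fst _ _).comp α.range.subtype
  refine ⟨α.range, inferInstance,
    MulAction.compHom ℕ ((MonoidHom.snd _ _).comp α.range.subtype), ?_, ?_, ?_⟩
  · have : Countable (FreeGroup (Σ n, (Fin n ↪ ℕ) × (Fin n ↪ ℕ))) :=
      Quot.mk_surjective.countable
    exact (Set.countable_range α).to_subtype
  -- Every colour occurs, so the order automorphism determines the permutation of colours. Thus Γ
  -- embeds in the left-orderable group of order automorphisms.
  · refine TwoUniqueProds.of_injective_mulHom f.toMulHom ?_ (twoUniqueProds_orderIso ColoredRat)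
    rintro ⟨_, w, rfl⟩ ⟨_, w', rfl⟩ h
    have h : (α w).1 = (α w').1 := h
    refine Subtype.ext (Prod.ext h (Equiv.ext fun k => ?_))
    have h1 := hα w ⟨0, k⟩
    rw [h, hα w'] at h1
    exact h1.symm
  · intro n u v
    refine ⟨⟨α (FreeGroup.of ⟨n, u, v⟩), _, rfl⟩, fun i => ?_⟩
    have : α (FreeGroup.of ⟨n, u, v⟩) = (g ⟨n, u, v⟩, π ⟨n, u, v⟩) := by simp [α]
    change (α (FreeGroup.of ⟨n, u, v⟩)).2 (u i) = v i
    rw [this]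
    exact hπ ⟨n, u, v⟩ i

end OrderedGroup

/-! ### Points with evaluations, and lifting permutations to them -/

section Generic

/-- Points labelled by a list, with a finite list of prescribed evaluations and a multiplicity. -/
abbrev Pt : Type := List ℕ × List ℕ × ℕ

namespace Pt

/-- The `n`-th evaluation of a point: prescribed for small `n`, and eventually the code of the
point. -/
def eval (n : ℕ) (a : Pt) : ℕ := a.2.1.getD n (Encodable.encode a)

theorem eventually_eval_ne {a b : Pt} (h : a ≠ b) : ∃ n₀, ∀ n ≥ n₀, eval n a ≠ eval n b := by
  refine ⟨max a.2.1.length b.2.1.length, fun n hn => ?_⟩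
  rw [eval, eval, List.getD_eq_default _ _ (le_trans (le_max_left _ _) hn),
    List.getD_eq_default _ _ (le_trans (le_max_right _ _) hn)]
  exact fun h' => h (Encodable.encode_injective h')

theorem eventually_eval_injOn (F : Finset Pt) :
    ∃ n₀, ∀ n ≥ n₀, Set.InjOn (eval n) (F : Set Pt) := by
  classical
  have : ∀ p : Pt × Pt, ∃ n₀, ∀ n ≥ n₀, p.1 ≠ p.2 → eval n p.1 ≠ eval n p.2 := fun p => by
    by_cases h : p.1 = p.2
    · exact ⟨0, fun _ _ h' => (h' h).elim⟩
    · obtain ⟨n₀, h⟩ := eventually_eval_ne h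
      exact ⟨n₀, fun n hn _ => h n hn⟩
  choose k hk using this
  refine ⟨(F ×ˢ F).sup k, fun n hn a ha b hb hab => ?_⟩
  by_contra hne
  exact hk (a, b) n (le_trans (Finset.le_sup (f := k) (Finset.mk_mem_product ha hb)) hn) hne hab

/-- The first `n₀` evaluations are stored in the list, and the later ones are all the code of the
point. Varying the multiplicity gives infinitely many codes, so one avoids the finitely many values
taken on `F`. -/
theorem exists_generic (l : List ℕ) (w : ℕ → ℕ) (n₀ : ℕ) (F : Finset Pt) :
    ∃ b : Pt, b.1 = l ∧ (∀ n < n₀, eval n b = w n) ∧ ∀ n ≥ n₀, ∀ f ∈ F, eval n b ≠ eval n f := by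
  classical
  let bad : Finset ℕ := F.biUnion fun f => insert (Encodable.encode f) f.2.1.toFinset
  let P : ℕ → Pt := fun k => (l, (List.range n₀).map w, k)
  have hP : Injective fun k => Encodable.encode (P k) := fun k k' h => by
    have := Encodable.encode_injective h
    simpa [P] using this
  obtain ⟨_, ⟨k, rfl⟩, hk⟩ := (Set.infinite_range_of_injective hP).exists_notMem_finset bad
  refine ⟨P k, rfl, fun n hn => ?_, fun n hn f hf he => hk ?_⟩
  · simp [eval, P, hn]
  · have h1 : eval n (P k) = Encodable.encode (P k) := by
      rw [eval, List.getD_eq_default]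
      simpa [P] using hn
    change Encodable.encode (P k) ∈ bad
    rw [← h1, he, Finset.mem_biUnion]
    refine ⟨f, hf, ?_⟩
    rw [eval]
    by_cases h : n < f.2.1.length
    · rw [List.getD_eq_getElem _ _ h]
      exact Finset.mem_insert_of_mem (List.mem_toFinset.2 (List.getElem_mem h))
    · rw [List.getD_eq_default _ _ (not_lt.1 h)]
      exact Finset.mem_insert_self _ _

variable {Γ : Type*} [Group Γ] [MulAction Γ ℕ]

theorem exists_smul_eq_of_injective
    (hΓ : ∀ n (u v : Fin n ↪ ℕ), ∃ γ : Γ, ∀ i, γ • u i = v i)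
    {ι : Type*} [Finite ι] {u v : ι → ℕ} (hu : Injective u) (hv : Injective v) :
    ∃ γ : Γ, ∀ i, γ • u i = v i := by
  let e := Finite.equivFin ι
  obtain ⟨γ, h⟩ := hΓ _ ⟨u ∘ e.symm, hu.comp e.symm.injective⟩ ⟨v ∘ e.symm, hv.comp e.symm.injective⟩
  exact ⟨γ, fun i => by simpa using h (e i)⟩

variable (Γ) in
/-- A finite approximation to a lift of `π` to points, with finitely many group elements fixed. -/
structure Approx (π : Equiv.Perm ℕ) where
  graph : Finset (Pt × Pt)
  level : ℕ
  elt : ℕ → Γ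
  label : ∀ p ∈ graph, p.2.1 = p.1.1.map π
  eval_eq : ∀ n < level, ∀ p ∈ graph, eval n p.2 = elt n • eval n p.1
  inj_left : ∀ n ≥ level, ∀ p ∈ graph, ∀ q ∈ graph, eval n p.1 = eval n q.1 → p = q
  inj_right : ∀ n ≥ level, ∀ p ∈ graph, ∀ q ∈ graph, eval n p.2 = eval n q.2 → p = q

namespace Approx

variable {π : Equiv.Perm ℕ}

instance : Preorder (Approx Γ π) where
  le s t := s.graph ⊆ t.graph ∧ s.level ≤ t.level ∧ ∀ n < s.level, t.elt n = s.elt n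
  le_refl s := ⟨subset_rfl, le_rfl, fun _ _ => rfl⟩
  le_trans s t u h h' := ⟨h.1.trans h'.1, h.2.1.trans h'.2.1, fun n hn =>
    (h'.2.2 n (hn.trans_le h.2.1)).trans (h.2.2 n hn)⟩

theorem graph_subset {s t : Approx Γ π} (h : s ≤ t) : s.graph ⊆ t.graph := h.1

/-- At a level not yet fixed both columns of the graph have distinct evaluations, so high
transitivity supplies a group element carrying one column to the other. -/
theorem exists_level (hΓ : ∀ n (u v : Fin n ↪ ℕ), ∃ γ : Γ, ∀ i, γ • u i = v i)
    (s : Approx Γ π) (N : ℕ) : ∃ t, s ≤ t ∧ t.graph = s.graph ∧ N ≤ t.level := by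
  have : ∀ n, ∃ γ : Γ, s.level ≤ n → ∀ p ∈ s.graph, eval n p.2 = γ • eval n p.1 := fun n => by
    by_cases hn : s.level ≤ n
    · obtain ⟨γ, h⟩ := exists_smul_eq_of_injective hΓ (ι := s.graph)
        (u := fun p => eval n p.1.1) (v := fun p => eval n p.1.2)
        (fun p q h => Subtype.ext (s.inj_left n hn _ p.2 _ q.2 h))
        (fun p q h => Subtype.ext (s.inj_right n hn _ p.2 _ q.2 h))
      exact ⟨γ, fun _ p hp => (h ⟨p, hp⟩).symm⟩
    · exact ⟨1, fun h => (hn h).elim⟩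
  choose γ hγ using this
  refine ⟨⟨s.graph, max s.level N, fun n => if n < s.level then s.elt n else γ n, s.label, ?_,
    fun n hn => s.inj_left n (le_trans (le_max_left _ _) hn),
    fun n hn => s.inj_right n (le_trans (le_max_left _ _) hn)⟩,
    ⟨subset_rfl, le_max_left _ _, fun n hn => if_pos hn⟩, rfl, le_max_right _ _⟩
  intro n _ p hp
  by_cases h : n < s.level
  · rw [if_pos h]; exact s.eval_eq n h p hp
  · rw [if_neg h]; exact hγ n (not_lt.1 h) p hp

theorem exists_insert (s : Approx Γ π) (a b : Pt) (hab : b.1 = a.1.map π)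
    (h : ∀ n < s.level, eval n b = s.elt n • eval n a)
    (ha : ∀ n ≥ s.level, ∀ p ∈ s.graph, eval n a ≠ eval n p.1)
    (hb : ∀ n ≥ s.level, ∀ p ∈ s.graph, eval n b ≠ eval n p.2) :
    ∃ t, s ≤ t ∧ (a, b) ∈ t.graph := by
  classical
  refine ⟨⟨insert (a, b) s.graph, s.level, s.elt, ?_, ?_, ?_, ?_⟩,
    ⟨Finset.subset_insert _ _, le_rfl, fun _ _ => rfl⟩, Finset.mem_insert_self _ _⟩
  · intro p hp
    rcases Finset.mem_insert.1 hp with rfl | hp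
    exacts [hab, s.label p hp]
  · intro n hn p hp
    rcases Finset.mem_insert.1 hp with rfl | hp
    exacts [h n hn, s.eval_eq n hn p hp]
  · intro n hn p hp q hq e
    rcases Finset.mem_insert.1 hp with rfl | hp <;> rcases Finset.mem_insert.1 hq with rfl | hq
    exacts [rfl, (ha n hn q hq e).elim, (ha n hn p hp e.symm).elim, s.inj_left n hn p hp q hq e]
  · intro n hn p hp q hq e
    rcases Finset.mem_insert.1 hp with rfl | hp <;> rcases Finset.mem_insert.1 hq with rfl | hq
    exacts [rfl, (hb n hn q hq e).elim, (hb n hn p hp e.symm).elim, s.inj_right n hn p hp q hq e]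

theorem forth (hΓ : ∀ n (u v : Fin n ↪ ℕ), ∃ γ : Γ, ∀ i, γ • u i = v i)
    (s : Approx Γ π) (a : Pt) : ∃ t, s ≤ t ∧ ∃ b, (a, b) ∈ t.graph := by
  classical
  by_cases h : ∃ b, (a, b) ∈ s.graph
  · exact ⟨s, le_rfl, h⟩
  -- Raise the level until all unfixed evaluations separate `a` from the current domain; then take a
  -- generic image whose fixed evaluations are the ones forced by the chosen group elements.
  obtain ⟨n₀, hn₀⟩ := eventually_eval_injOn (insert a (s.graph.image Prod.fst))
  obtain ⟨t, hst, hg, hN⟩ := s.exists_level hΓ n₀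
  obtain ⟨b, hb, hb1, hb2⟩ := exists_generic (a.1.map π) (fun n => t.elt n • eval n a) t.level
    (t.graph.image Prod.snd)
  obtain ⟨u, htu, hu⟩ := t.exists_insert a b hb hb1 (fun n hn p hp e => by
      rw [hg] at hp
      have := hn₀ n (hN.trans hn) (Finset.mem_coe.2 (Finset.mem_insert_self _ _))
        (Finset.mem_coe.2 (Finset.mem_insert_of_mem (Finset.mem_image_of_mem _ hp))) e
      exact h ⟨p.2, this ▸ hp⟩)
    (fun n hn p hp => hb2 n hn _ (Finset.mem_image_of_mem _ hp))
  exact ⟨u, hst.trans htu, b, hu⟩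

theorem back (hΓ : ∀ n (u v : Fin n ↪ ℕ), ∃ γ : Γ, ∀ i, γ • u i = v i)
    (s : Approx Γ π) (b : Pt) : ∃ t, s ≤ t ∧ ∃ a, (a, b) ∈ t.graph := by
  classical
  by_cases h : ∃ a, (a, b) ∈ s.graph
  · exact ⟨s, le_rfl, h⟩
  obtain ⟨n₀, hn₀⟩ := eventually_eval_injOn (insert b (s.graph.image Prod.snd))
  obtain ⟨t, hst, hg, hN⟩ := s.exists_level hΓ n₀
  obtain ⟨a, ha, ha1, ha2⟩ := exists_generic (b.1.map π.symm) (fun n => (t.elt n)⁻¹ • eval n b)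
    t.level (t.graph.image Prod.fst)
  obtain ⟨u, htu, hu⟩ := t.exists_insert a b (by simp [ha, comp_def])
    (fun n hn => by rw [ha1 n hn, smul_inv_smul])
    (fun n hn p hp => ha2 n hn _ (Finset.mem_image_of_mem _ hp))
    (fun n hn p hp e => by
      rw [hg] at hp
      have := hn₀ n (hN.trans hn) (Finset.mem_coe.2 (Finset.mem_insert_self _ _))
        (Finset.mem_coe.2 (Finset.mem_insert_of_mem (Finset.mem_image_of_mem _ hp))) e
      exact h ⟨p.1, this ▸ hp⟩)
  exact ⟨u, hst.trans htu, a, hu⟩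

end Approx

/-- Every permutation of `ℕ` lifts to the points, acting on each evaluation through `Γ`. -/
theorem exists_lift (hΓ : ∀ n (u v : Fin n ↪ ℕ), ∃ γ : Γ, ∀ i, γ • u i = v i)
    (π : Equiv.Perm ℕ) : ∃ (s : Equiv.Perm Pt) (σ : ℕ → Γ),
      (∀ a, (s a).1 = a.1.map π) ∧ ∀ n a, eval n (s a) = σ n • eval n a := by
  obtain ⟨e, I, he, hD⟩ := exists_equiv_of_backAndForth (S := Approx Γ π)
    ⟨∅, 0, fun _ => 1, by simp, by simp, by simp, by simp⟩
    (fun s => (s.graph : Set (Pt × Pt))) (fun s t h => Finset.coe_subset.2 (Approx.graph_subset h))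
    (Approx.forth hΓ) (Approx.back hΓ)
    (fun s a a' b b' h h' => by
      refine ⟨fun e => ?_, fun e => ?_⟩
      · exact congrArg Prod.snd (s.inj_left s.level le_rfl _ h _ h' (congrArg _ e))
      · exact congrArg Prod.fst (s.inj_right s.level le_rfl _ h _ h' (congrArg _ e)))
    (fun n => {s | n < s.level})
    (fun n s => by
      obtain ⟨t, h, -, h'⟩ := s.exists_level hΓ (n + 1)
      exact ⟨t, h, h'⟩)
  choose t ht ht' using hD
  refine ⟨e, fun n => (t n).elt n, fun a => ?_, fun n a => ?_⟩
  · obtain ⟨s, -, h⟩ := he a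
    exact s.label _ h
  · obtain ⟨s, hs, h⟩ := he a
    obtain ⟨u, -, hu, hu'⟩ := I.directed s hs (t n) (ht n)
    change _ = (t n).elt n • _
    rw [← hu'.2.2 n (ht' n)]
    exact u.eval_eq n (lt_of_lt_of_le (ht' n) hu'.2.1) _ (hu.1 h)

end Pt

end Generic

/-! ### Linear maps induced by partial functions on bases -/

section PartialAct

variable {R : Type*} [Ring R] {N : Type*} [AddCommGroup N] [Module R N] {X Y Z : Type*}

variable (R N) in
/-- The linear map induced by a partial function between bases. -/
noncomputable def partialAct (f : X → Option Y) : (X →₀ N) →ₗ[R] (Y →₀ N) :=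
  Finsupp.lsum ℕ fun x => (f x).elim 0 Finsupp.lsingle

theorem partialAct_single (f : X → Option Y) (x : X) (a : N) :
    partialAct R N f (Finsupp.single x a) = (f x).elim 0 (fun y => Finsupp.single y a) := by
  rw [partialAct, Finsupp.lsum_single]
  cases f x <;> rfl

theorem partialAct_single_some {f : X → Option Y} {x : X} {y : Y} (h : f x = some y) (a : N) :
    partialAct R N f (Finsupp.single x a) = Finsupp.single y a := by
  rw [partialAct_single, h]; rfl

theorem partialAct_single_none {f : X → Option Y} {x : X} (h : f x = none) (a : N) :
    partialAct R N f (Finsupp.single x a) = 0 := by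
  rw [partialAct_single, h]; rfl

theorem partialAct_partialAct (f : X → Option Y) (g : Y → Option Z) (v : X →₀ N) :
    partialAct R N g (partialAct R N f v) = partialAct R N (fun x => (f x).bind g) v := by
  induction v using Finsupp.induction_linear with
  | zero => simp
  | add v w hv hw => simp [hv, hw]
  | single x a =>
    rw [partialAct_single, partialAct_single]
    cases h : f x with
    | none => simp
    | some y => simp [partialAct_single]

theorem partialAct_some (v : X →₀ N) : partialAct R N some v = v := by
  induction v using Finsupp.induction_linear with
  | zero => simp
  | add v w hv hw => simp [hv, hw]
  | single x a => rw [partialAct_single_some rfl]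

/-- Partial functions may identify basis elements, so coefficients can merge or cancel; this does
not happen at `y` if only one support element maps there. -/
theorem partialAct_apply_of_unique {f : X → Option Y} {v : X →₀ N} {x : X} {y : Y}
    (hx : f x = some y) (h : ∀ x' ∈ v.support, f x' = some y → x' = x) :
    partialAct R N f v y = v x := by
  classical
  have key : ∀ x' a, (partialAct R N f (Finsupp.single x' a)) y = if f x' = some y then a else 0 := by
    intro x' a
    rw [partialAct_single]
    cases hx' : f x' with
    | none => simp
    | some z => simp [Finsupp.single_apply]
  conv_lhs => rw [← Finsupp.sum_single v]
  rw [Finsupp.sum, map_sum, Finsupp.finsetSum_apply, Finset.sum_congr rfl fun i _ => key i _,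
    Finset.sum_eq_single x]
  · rw [if_pos hx]
  · intro x' hx' hne
    exact if_neg fun e => hne (h x' hx' e)
  · intro hx'
    rw [Finsupp.notMem_support_iff.1 hx', ite_self]

theorem partialAct_apply_of_notMem {f : X → Option Y} (v : X →₀ N) {y : Y}
    (h : ∀ x, f x ≠ some y) : partialAct R N f v y = 0 := by
  classical
  induction v using Finsupp.induction_linear with
  | zero => simp
  | add v w hv hw => simp [hv, hw]
  | single x a =>
    rw [partialAct_single]
    cases hx : f x with
    | none => simp
    | some z =>
      have : z ≠ y := fun e => h x (e ▸ hx)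
      simp [this]

end PartialAct

/-! ### Trivial units in group rings with two unique products -/

section TrivialUnits

variable {R : Type*} [Ring R] {N : Type*} [AddCommGroup N] [Module R N] {Γ : Type*} [Group Γ]

theorem LinearMap.eq_zero_of_apply_eq_zero [IsSimpleModule R N] (u : N →ₗ[R] N) {a b : N} (ha : a ≠ 0) (h : u a = 0) :
    u b = 0 := by
  rcases LinearMap.injective_or_eq_zero u with hu | hu
  · exact (ha (hu (by rw [h, map_zero]))).elim
  · rw [hu]; rfl

/-- A map commuting with right translations is determined by its coefficients at `1`. -/
theorem apply_eq_sum_of_commute_mulRight (θ : (Γ →₀ N) →ₗ[R] (Γ →₀ N))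
    (hθ : ∀ γ v, θ (partialAct R N (fun g : Γ => some (g * γ)) v) =
      partialAct R N (fun g => some (g * γ)) (θ v)) (v : Γ →₀ N) (k : Γ) :
    θ v k = ∑ h ∈ v.support, θ (Finsupp.single 1 (v h)) (k * h⁻¹) := by
  conv_lhs => rw [← Finsupp.sum_single v]
  rw [Finsupp.sum, map_sum, Finsupp.finsetSum_apply]
  refine Finset.sum_congr rfl fun h _ => ?_
  have : Finsupp.single h (v h) =
      partialAct R N (fun g : Γ => some (g * h)) (Finsupp.single 1 (v h)) := by
    rw [partialAct_single, one_mul]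
    rfl
  rw [this, hθ]
  refine partialAct_apply_of_unique (by simp) fun x' _ e => ?_
  rw [Option.some_inj] at e
  rw [← e, mul_inv_cancel_right]

/-- The group ring of a group with two unique products over a division ring has only trivial
units. -/
theorem exists_eq_single_of_commute_mulRight [IsSimpleModule R N] [TwoUniqueProds Γ]
    (θ : (Γ →₀ N) ≃ₗ[R] (Γ →₀ N))
    (hθ : ∀ γ v, θ (partialAct R N (fun g : Γ => some (g * γ)) v) =
      partialAct R N (fun g => some (g * γ)) (θ v)) :
    ∃ σ : Γ, ∀ g a, ∃ c, θ (Finsupp.single g a) = Finsupp.single (σ * g) c := by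
  classical
  have hθ' : ∀ γ v, θ.symm (partialAct R N (fun g : Γ => some (g * γ)) v) =
      partialAct R N (fun g => some (g * γ)) (θ.symm v) := fun γ v => by
    rw [LinearEquiv.symm_apply_eq, hθ, LinearEquiv.apply_symm_apply]
  have : Nontrivial N := IsSimpleModule.nontrivial R N
  obtain ⟨a₀, ha₀⟩ := exists_ne (0 : N)
  -- Each matrix coefficient is an endomorphism of the simple module `N`, so it is injective or
  -- zero, and the supports below do not depend on the nonzero vector chosen.
  have schur : ∀ (φ : (Γ →₀ N) ≃ₗ[R] (Γ →₀ N)) (h : Γ) (a b : N), a ≠ 0 →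
      φ (Finsupp.single 1 a) h = 0 → φ (Finsupp.single 1 b) h = 0 := fun φ h a b ha e =>
    LinearMap.eq_zero_of_apply_eq_zero
      ((Finsupp.lapply h).comp (φ.toLinearMap.comp (Finsupp.lsingle 1))) ha e
  set S := (θ (Finsupp.single 1 a₀)).support with hS
  set T := (θ.symm (Finsupp.single 1 a₀)).support with hT
  have hne : ∀ φ : (Γ →₀ N) ≃ₗ[R] (Γ →₀ N), (φ (Finsupp.single 1 a₀)).support.Nonempty := by
    intro φ
    rw [Finsupp.support_nonempty_iff]
    simpa using ha₀
  -- At a uniquely represented product only one term of the composite of `θ.symm` and `θ` survives,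
  -- and it is nonzero. The composite is the identity, so the product must be 1.
  have hprod : ∀ g₀ ∈ T, ∀ h₀ ∈ S, UniqueMul T S g₀ h₀ → g₀ * h₀ = 1 := by
    intro g₀ hg₀ h₀ hh₀ hu
    have h1 := apply_eq_sum_of_commute_mulRight θ.symm.toLinearMap hθ'
      (θ (Finsupp.single 1 a₀)) (g₀ * h₀)
    rw [Finset.sum_eq_single h₀] at h1
    · by_contra hne1
      simp only [LinearEquiv.coe_coe, LinearEquiv.symm_apply_apply, mul_inv_cancel_right] at h1
      rw [Finsupp.single_eq_of_ne hne1] at h1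
      exact Finsupp.mem_support_iff.1 hg₀
        (schur _ _ _ _ (Finsupp.mem_support_iff.1 hh₀) h1.symm)
    · intro h hh hne1
      by_contra hc
      have hmem : g₀ * h₀ * h⁻¹ ∈ T := by
        rw [hT, Finsupp.mem_support_iff]
        exact fun e => hc (schur _ _ _ _ ha₀ e)
      exact hne1 (hu hmem hh (by simp)).2
    · exact fun h => (h hh₀).elim
  -- Two distinct unique products would both equal 1, contradicting uniqueness.
  have hcard : ¬ 1 < T.card * S.card := by
    intro hc
    obtain ⟨p, hp, q, hq, hpq, hup, huq⟩ := TwoUniqueProds.uniqueMul_of_one_lt_card hc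
    rw [Finset.mem_product] at hp hq
    have e := (hprod _ hp.1 _ hp.2 hup).trans (hprod _ hq.1 _ hq.2 huq).symm
    have := huq hp.1 hp.2 e
    exact hpq (Prod.ext this.1 this.2)
  have hT1 : 0 < T.card := Finset.card_pos.2 (hne θ.symm)
  have hS1 : S.card = 1 := by
    have : 0 < S.card := Finset.card_pos.2 (hne θ)
    nlinarith
  obtain ⟨σ, hσ⟩ := Finset.card_eq_one.1 hS1
  refine ⟨σ, fun g a => ⟨θ (Finsupp.single 1 a) σ, Finsupp.ext fun k => ?_⟩⟩
  by_cases ha : a = 0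
  · subst ha; simp
  rw [← LinearEquiv.coe_coe, apply_eq_sum_of_commute_mulRight θ.toLinearMap hθ,
    Finsupp.support_single _ ha, Finset.sum_singleton, Finsupp.single_eq_same]
  by_cases hk : k = σ * g
  · subst hk; simp
  · rw [Finsupp.single_eq_of_ne hk]
    have : k * g⁻¹ ∉ S := by
      rw [hσ, Finset.mem_singleton]
      rintro rfl
      simp at hk
    exact schur _ _ _ _ ha₀ (Finsupp.notMem_support_iff.1 this)

end TrivialUnits

/-! ### Rigidity: commuting isomorphisms permute the basis up to coefficients -/

section Rigid

variable (Γ : Type*) (S : Type*)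

/-- The basis: points, copies of the regular representation of `Γ`, copies of `ℕ` receiving the
evaluations, and the universe `ℕ`. -/
inductive Vertex
  | pt (a : Pt)
  | tors (n : ℕ) (g : Γ)
  | val (n w : ℕ)
  | elt (m : ℕ)

theorem Vertex.pt_injective {Γ : Type*} : Injective (Vertex.pt : Pt → Vertex Γ) := fun _ _ h => by
  simpa using h

/-- Names for the partial functions on the basis. -/
inductive Op
  | pts
  | block (n : ℕ)
  | mulRight (γ : Γ)
  | orbit
  | eval (n : ℕ)
  | coord (i : ℕ)
  | pred (j : S)

variable {Γ S} {R : Type*} [Ring R] {N : Type*} [AddCommGroup N] [Module R N]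

/-- The projection onto the `n`-th copy of `Γ`. -/
def torsProj (n : ℕ) : Vertex Γ → Option Γ
  | .tors m g => if m = n then some g else none
  | _ => none

theorem torsProj_embed (n : ℕ) (v : Γ →₀ N) :
    partialAct R N (torsProj n) (partialAct R N (fun g => some (Vertex.tors n g)) v) = v := by
  rw [partialAct_partialAct]
  conv_rhs => rw [← partialAct_some (R := R) v]
  congr 1
  congr 1
  funext y
  simp [torsProj]

variable [Group Γ] [MulAction Γ ℕ]

open Classical in
/-- The partial functions on the basis encoding a family of sets of lists. -/
noncomputable def Op.fn (P : S → Set (List ℕ)) : Op Γ S → Vertex Γ → Option (Vertex Γ)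
  | .pts, .pt a => some (.pt a)
  | .block n, .tors m g => if m = n then some (.tors m g) else none
  | .mulRight γ, .tors m g => some (.tors m (g * γ))
  | .orbit, .tors m g => some (.val m (g • 0))
  | .eval n, .pt a => some (.val n (a.eval n))
  | .coord i, .pt a => a.1[i]?.map .elt
  | .pred j, .pt a => if a.1 ∈ P j then some (.pt a) else none
  | _, _ => none

theorem embed_torsProj (P : S → Set (List ℕ)) (n : ℕ) (v : Vertex Γ →₀ N) :
    partialAct R N (fun g => some (Vertex.tors n g)) (partialAct R N (torsProj n) v) =
      partialAct R N ((Op.block n : Op Γ S).fn P) v := by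
  rw [partialAct_partialAct]
  congr 1
  congr 1
  funext y
  cases y <;> simp [torsProj, Op.fn]
  split_ifs with h <;> simp [h]

theorem block_embed (P : S → Set (List ℕ)) (n : ℕ) (v : Γ →₀ N) :
    partialAct R N ((Op.block n : Op Γ S).fn P)
      (partialAct R N (fun g => some (Vertex.tors n g)) v) =
    partialAct R N (fun g => some (Vertex.tors n g)) v := by
  rw [← embed_torsProj, torsProj_embed]

variable {P P' : S → Set (List ℕ)}
  (θ : (Vertex Γ →₀ N) ≃ₗ[R] (Vertex Γ →₀ N))
  (hθ : ∀ (o : Op Γ S) v, θ (partialAct R N (o.fn P) v) = partialAct R N (o.fn P') (θ v))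

include hθ

theorem commute_symm (o : Op Γ S) (v : Vertex Γ →₀ N) :
    θ.symm (partialAct R N (o.fn P') v) = partialAct R N (o.fn P) (θ.symm v) := by
  rw [LinearEquiv.symm_apply_eq, hθ, LinearEquiv.apply_symm_apply]

theorem apply_single_pt (a : Pt) (x : N) (y : Vertex Γ) (h : ∀ b, y ≠ .pt b) :
    θ (Finsupp.single (.pt a) x) y = 0 := by
  have h1 := hθ .pts (Finsupp.single (.pt a) x)
  simp only [partialAct_single (x := Vertex.pt a), Op.fn, Option.elim_some] at h1
  rw [h1]
  refine partialAct_apply_of_notMem _ fun z hz => ?_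
  cases z <;> simp only [Op.fn, reduceCtorEq, Option.some_inj] at hz
  exact h _ hz.symm

variable [IsSimpleModule R N] [TwoUniqueProds Γ]

/-- Commuting with the block projection restricts `θ` to an automorphism of the `n`-th copy of the
regular representation. It commutes with right translations there, so the trivial-units theorem
applies. -/
theorem exists_tors (n : ℕ) : ∃ σ : Γ, ∀ g a, ∃ c,
    θ (Finsupp.single (.tors n g) a) = Finsupp.single (.tors n (σ * g)) c := by
  let ε : (Γ →₀ N) →ₗ[R] (Vertex Γ →₀ N) := partialAct R N (fun g => some (Vertex.tors n g))
  let ρ : (Vertex Γ →₀ N) →ₗ[R] (Γ →₀ N) := partialAct R N (torsProj n)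
  have aux : ∀ (φ : (Vertex Γ →₀ N) ≃ₗ[R] (Vertex Γ →₀ N)) (Q Q' : S → Set (List ℕ)),
      (∀ (o : Op Γ S) v, φ (partialAct R N (o.fn Q) v) = partialAct R N (o.fn Q') (φ v)) →
      ∀ v, ε (ρ (φ (ε v))) = φ (ε v) := fun φ Q Q' hφ v => by
    rw [embed_torsProj Q', ← hφ, block_embed]
  let φ : (Γ →₀ N) ≃ₗ[R] (Γ →₀ N) := LinearEquiv.ofLinearMap
    (ρ.comp (θ.toLinearMap.comp ε)) (ρ.comp (θ.symm.toLinearMap.comp ε))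
    (LinearMap.ext fun v => by
      simp only [LinearMap.comp_apply, LinearEquiv.coe_coe]
      rw [aux θ.symm P' P (commute_symm θ hθ), LinearEquiv.apply_symm_apply]
      exact torsProj_embed n v)
    (LinearMap.ext fun v => by
      simp only [LinearMap.comp_apply, LinearEquiv.coe_coe]
      rw [aux θ P P' hθ, LinearEquiv.symm_apply_apply]
      exact torsProj_embed n v)
  have hφ : ∀ v, φ v = ρ (θ (ε v)) := fun v => rfl
  obtain ⟨σ, hσ⟩ := exists_eq_single_of_commute_mulRight φ (fun γ v => by
    rw [hφ, hφ]
    have h1 : ε (partialAct R N (fun g => some (g * γ)) v) =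
        partialAct R N ((Op.mulRight γ : Op Γ S).fn P) (ε v) := by
      simp only [ε, partialAct_partialAct]; rfl
    rw [h1, hθ]
    simp only [ρ, partialAct_partialAct]
    congr 1
    congr 1
    funext y
    cases y <;> simp [torsProj, Op.fn]
    split_ifs <;> simp)
  refine ⟨σ, fun g a => ?_⟩
  obtain ⟨c, hc⟩ := hσ g a
  refine ⟨c, ?_⟩
  have h1 : ε (Finsupp.single g a) = Finsupp.single (.tors n g) a :=
    partialAct_single_some (f := fun g => some (Vertex.tors n g)) rfl a
  have h2 := aux θ P P' hθ (Finsupp.single g a)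
  rw [← hφ, hc, h1] at h2
  rw [← h2]
  exact partialAct_single_some (R := R) (f := fun g => some (Vertex.tors n g)) rfl c

/-- The orbit map of 0 is onto and intertwines left multiplication by σ on Γ with the action of σ on
ℕ. -/
theorem exists_val (hΓ : ∀ w : ℕ, ∃ γ : Γ, γ • 0 = w) (n : ℕ) : ∃ σ : Γ, ∀ w a, ∃ c,
    θ (Finsupp.single (.val n w) a) = Finsupp.single (.val n (σ • w)) c := by
  obtain ⟨σ, hσ⟩ := exists_tors θ hθ n
  refine ⟨σ, fun w a => ?_⟩
  obtain ⟨g, rfl⟩ := hΓ w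
  obtain ⟨c, hc⟩ := hσ g a
  refine ⟨c, ?_⟩
  have h := hθ .orbit (Finsupp.single (.tors n g) a)
  simp only [hc, partialAct_single, Op.fn, Option.elim_some, mul_smul] at h
  exact h

/-- For large `n` evaluation separates the points of a finite support, so no cancellation occurs,
while the evaluated image sits at one place. Hence every point in the support has evaluations `σ n •
a.eval n` for all large `n`. As σ does not depend on the coefficient, the image point does not
either. -/
theorem exists_pt (hΓ : ∀ w : ℕ, ∃ γ : Γ, γ • 0 = w) (a : Pt) : ∃ b : Pt, ∀ x, ∃ c,
    θ (Finsupp.single (.pt a) x) = Finsupp.single (.pt b) c := by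
  classical
  choose σ hσ using exists_val θ hθ hΓ
  have key : ∀ (x : N) (F : Finset Pt), ∃ n₀, ∀ n ≥ n₀, ∀ b ∈ F,
      θ (Finsupp.single (.pt a) x) (.pt b) ≠ 0 → b.eval n = σ n • a.eval n := by
    intro x F
    set v := θ (Finsupp.single (.pt a) x) with hv
    obtain ⟨n₀, hn₀⟩ := Pt.eventually_eval_injOn
      (F ∪ v.support.preimage Vertex.pt Vertex.pt_injective.injOn)
    refine ⟨n₀, fun n hn b hb hb0 => ?_⟩
    obtain ⟨c, hc⟩ := hσ n (a.eval n) x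
    have h1 := hθ (.eval n) (Finsupp.single (.pt a) x)
    simp only [partialAct_single, Op.fn, Option.elim_some, hc, ← hv] at h1
    have h2 : partialAct R N ((Op.eval n : Op Γ S).fn P') v (.val n (b.eval n)) = v (.pt b) := by
      refine partialAct_apply_of_unique rfl fun y hy e => ?_
      cases y with
      | pt b' =>
        simp only [Op.fn, Option.some_inj, Vertex.val.injEq, true_and] at e
        rw [hn₀ n hn (by
          rw [Finset.mem_coe, Finset.mem_union, Finset.mem_preimage]; exact Or.inr hy) (by simp [hb]) e]
      | _ => simp [Op.fn] at e
    rw [← h1, Finsupp.single_apply] at h2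
    by_contra hne
    rw [if_neg (by simpa [eq_comm] using hne)] at h2
    exact hb0 h2.symm
  have : Nontrivial N := IsSimpleModule.nontrivial R N
  have hex : ∀ x : N, x ≠ 0 → ∃ b, θ (Finsupp.single (.pt a) x) (.pt b) ≠ 0 := by
    -- The image of a point vector is supported on points, so if all its point coefficients vanished
    -- it would be zero.
    intro x hx
    by_contra! hb
    refine hx ?_
    have : θ (Finsupp.single (.pt a) x) = 0 := Finsupp.ext fun y => by
      cases y with
      | pt b => exact hb b
      | _ => exact apply_single_pt θ hθ a x _ (by simp)
    simpa using this
  obtain ⟨x₀, hx₀⟩ := exists_ne (0 : N)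
  obtain ⟨b, hb⟩ := hex x₀ hx₀
  refine ⟨b, fun x => ⟨θ (Finsupp.single (.pt a) x) (.pt b), Finsupp.ext fun y => ?_⟩⟩
  cases y with
  | pt b' =>
    by_cases hbb : b' = b
    · subst hbb; simp
    · rw [Finsupp.single_eq_of_ne (by simpa using hbb)]
      by_contra hne
      obtain ⟨n₀, h0⟩ := key x₀ {b}
      obtain ⟨n₁, h1⟩ := key x {b'}
      obtain ⟨n₂, h2⟩ := Pt.eventually_eval_ne hbb
      let n := max n₀ (max n₁ n₂)
      exact h2 n (by omega) ((h1 n (by omega) b' (by simp) hne).trans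
        (h0 n (by omega) b (by simp) hb).symm)
  | _ =>
    rw [Finsupp.single_eq_of_ne (by simp)]
    exact apply_single_pt θ hθ a x _ (by simp)

/-- The coordinate maps send points to elements of the universe, so the monomial action on points
induces one on elements. The label of the image point is the mapped label, and the predicate
projections then show membership is preserved. -/
theorem exists_elt (hΓ : ∀ w : ℕ, ∃ γ : Γ, γ • 0 = w) : ∃ t : ℕ → ℕ,
    (∀ m x, ∃ c, θ (Finsupp.single (.elt m) x) = Finsupp.single (.elt (t m)) c) ∧
    ∀ j l, l ∈ P j → l.map t ∈ P' j := by
  choose s hs using exists_pt θ hθ hΓ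
  have : Nontrivial N := IsSimpleModule.nontrivial R N
  obtain ⟨x₀, hx₀⟩ := exists_ne (0 : N)
  have hcoord : ∀ (a : Pt) (i : ℕ) (x c : N), θ (Finsupp.single (.pt a) x) =
      Finsupp.single (.pt (s a)) c →
      θ (partialAct R N ((Op.coord i : Op Γ S).fn P) (Finsupp.single (.pt a) x)) =
        (((s a).1[i]?).map Vertex.elt).elim 0 (fun y => Finsupp.single y c) := by
    intro a i x c hc
    rw [hθ, hc, partialAct_single]
    rfl
  have hne : ∀ (a : Pt) c, θ (Finsupp.single (.pt a) x₀) = Finsupp.single (.pt (s a)) c →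
      c ≠ 0 := by
    rintro a c hc rfl
    rw [Finsupp.single_zero, map_eq_zero_iff _ θ.injective] at hc
    exact hx₀ (by simpa using hc)
  have hsome : ∀ (a : Pt) (i m : ℕ), a.1[i]? = some m → ∃ m', (s a).1[i]? = some m' ∧
      ∀ x, ∃ c, θ (Finsupp.single (.elt m) x) = Finsupp.single (.elt m') c := by
    intro a i m hm
    have h0 : ∀ x c, θ (Finsupp.single (.pt a) x) = Finsupp.single (.pt (s a)) c →
        θ (Finsupp.single (.elt m) x) =
          (((s a).1[i]?).map Vertex.elt).elim 0 (fun y => Finsupp.single y c) := by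
      intro x c hc
      rw [← hcoord a i x c hc, partialAct_single_some]
      simp [Op.fn, hm]
    cases hm' : (s a).1[i]? with
    | none =>
      obtain ⟨c, hc⟩ := hs a x₀
      have := h0 x₀ c hc
      rw [hm'] at this
      simp only [Option.map_none, Option.elim_none, EmbeddingLike.map_eq_zero_iff,
        Finsupp.single_eq_zero] at this
      exact (hx₀ this).elim
    | some m' =>
      refine ⟨m', rfl, fun x => ?_⟩
      obtain ⟨c, hc⟩ := hs a x
      refine ⟨c, ?_⟩
      rw [h0 x c hc, hm']
      rfl
  have hnone : ∀ (a : Pt) (i : ℕ), a.1[i]? = none → (s a).1[i]? = none := by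
    intro a i h
    obtain ⟨c, hc⟩ := hs a x₀
    have h1 := hcoord a i x₀ c hc
    rw [partialAct_single_none (by simp [Op.fn, h]), map_zero] at h1
    cases hm' : (s a).1[i]? with
    | none => rfl
    | some m' =>
      rw [hm'] at h1
      exact (hne a c hc (by simpa using h1.symm)).elim
  have ht : ∀ m, ∃ m', ∀ x, ∃ c, θ (Finsupp.single (.elt m) x) = Finsupp.single (.elt m') c := by
    intro m
    -- A point labelled by the one-term list exhibits `m` as a coordinate.
    obtain ⟨m', -, h⟩ := hsome ([m], [], 0) 0 m rfl
    exact ⟨m', h⟩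
  choose t ht using ht
  refine ⟨t, ht, fun j l hl => ?_⟩
  let a : Pt := (l, [], 0)
  -- Comparing optional entries also shows that the two lists have the same length.
  have hmap : (s a).1 = l.map t := by
    refine List.ext_getElem? fun i => ?_
    rw [List.getElem?_map]
    cases h : l[i]? with
    | none => exact hnone a i h
    | some m =>
      obtain ⟨m', hm', hm''⟩ := hsome a i m h
      obtain ⟨c, hc⟩ := hm'' x₀
      obtain ⟨c', hc'⟩ := ht m x₀
      rw [hm', Option.map_some, Option.some_inj]
      rw [hc', Finsupp.single_eq_single_iff] at hc
      rcases hc with ⟨e, -⟩ | ⟨e, -⟩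
      · simpa using e.symm
      · rw [e, Finsupp.single_zero, EmbeddingLike.map_eq_zero_iff,
          Finsupp.single_eq_zero] at hc'
        exact (hx₀ hc').elim
  obtain ⟨c, hc⟩ := hs a x₀
  have h1 := hθ (.pred j) (Finsupp.single (.pt a) x₀)
  rw [partialAct_single_some (y := .pt a) (by simp [Op.fn, a, hl]), hc, partialAct_single] at h1
  by_contra hl'
  simp [Op.fn, hmap, hl'] at h1
  exact hne a c hc h1

/-- A linear isomorphism respecting the partial functions induces a permutation of the universe
respecting the encoded sets of lists. -/
theorem exists_perm_of_commute (hΓ : ∀ w : ℕ, ∃ γ : Γ, γ • 0 = w) :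
    ∃ π : Equiv.Perm ℕ, ∀ j l, l ∈ P j ↔ l.map π ∈ P' j := by
  obtain ⟨t, ht, htP⟩ := exists_elt θ hθ hΓ
  obtain ⟨t', ht', htP'⟩ := exists_elt θ.symm (commute_symm θ hθ) hΓ
  have : Nontrivial N := IsSimpleModule.nontrivial R N
  obtain ⟨x₀, hx₀⟩ := exists_ne (0 : N)
  have hinv : ∀ (φ : (Vertex Γ →₀ N) ≃ₗ[R] (Vertex Γ →₀ N)) (u u' : ℕ → ℕ),
      (∀ m x, ∃ c, φ (Finsupp.single (.elt m) x) = Finsupp.single (.elt (u m)) c) →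
      (∀ m x, ∃ c, φ.symm (Finsupp.single (.elt m) x) = Finsupp.single (.elt (u' m)) c) →
      LeftInverse u' u := by
    intro φ u u' hu hu' m
    obtain ⟨c, hc⟩ := hu m x₀
    obtain ⟨c', hc'⟩ := hu' (u m) c
    rw [← hc, LinearEquiv.symm_apply_apply, Finsupp.single_eq_single_iff] at hc'
    rcases hc' with ⟨e, -⟩ | ⟨e, -⟩
    · simpa using e.symm
    · exact (hx₀ e).elim
  refine ⟨⟨t, t', hinv θ t t' ht ht', hinv θ.symm t' t ht' ht⟩, fun j l => ⟨htP j l, fun h => ?_⟩⟩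
  have := htP' j _ h
  have e : t' ∘ t = id := funext (hinv θ t t' ht ht')
  simpa [e] using this

end Rigid

/-! ### Lifting isomorphisms of structures to the basis -/

section Lift

variable {Γ S : Type*} [Group Γ] [MulAction Γ ℕ] {P P' : S → Set (List ℕ)}

/-- A permutation of the universe respecting the encoded sets of lists lifts to the basis. -/
theorem exists_vertex_perm (hΓ : ∀ n (u v : Fin n ↪ ℕ), ∃ γ : Γ, ∀ i, γ • u i = v i)
    (π : Equiv.Perm ℕ) (hπ : ∀ j l, l ∈ P j ↔ l.map π ∈ P' j) :
    ∃ τ : Equiv.Perm (Vertex Γ), ∀ (o : Op Γ S) y, o.fn P' (τ y) = (o.fn P y).map τ := by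
  obtain ⟨s, σ, h1, h2⟩ := Pt.exists_lift hΓ π
  let F : Vertex Γ → Vertex Γ := fun y => match y with
    | .pt a => .pt (s a)
    | .tors n g => .tors n (σ n * g)
    | .val n w => .val n (σ n • w)
    | .elt m => .elt (π m)
  let G : Vertex Γ → Vertex Γ := fun y => match y with
    | .pt a => .pt (s.symm a)
    | .tors n g => .tors n ((σ n)⁻¹ * g)
    | .val n w => .val n ((σ n)⁻¹ • w)
    | .elt m => .elt (π.symm m)
  refine ⟨⟨F, G, fun y => by cases y <;> simp [F, G], fun y => by cases y <;> simp [F, G]⟩,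
    fun o y => ?_⟩
  change o.fn P' (F y) = (o.fn P y).map F
  cases o <;> cases y <;> simp [F, Op.fn, h1, h2, mul_smul, mul_assoc, ← hπ] <;>
    try (split_ifs <;> simp_all)
  simp [comp_def]

end Lift

/-! ### Coding countably many partial functions in one endomorphism -/

section OneEndomorphism

variable {Y J : Type*}

/-- The partial function used at the `s`-th special index. -/
def stepFn (f : J → Y → Option Y) (ty : ℕ → J × Bool) (s : ℕ) (y : Y) : Option Y :=
  if (ty s).2 then f (ty s).1 y else some y

open Classical in
/-- The partial function used by the `i`-th family of generators at index `m`; it is nontrivial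
only when `m` is a power of three. -/
noncomputable def tick (f : J → Y → Option Y) (ty : ℕ → J × Bool) (i : J) (m : ℤ) (y : Y) :
    Option Y :=
  if m = 3 ^ Nat.log 3 m.toNat ∧ (ty (Nat.log 3 m.toNat)).1 = i then
    stepFn f ty (Nat.log 3 m.toNat) y else none

open Classical in
theorem tick_pow (f : J → Y → Option Y) (ty : ℕ → J × Bool) (i : J) (s : ℕ) (y : Y) :
    tick f ty i (3 ^ s) y = if (ty s).1 = i then stepFn f ty s y else none := by
  have : Nat.log 3 ((3 : ℤ) ^ s).toNat = s := by
    rw [show ((3 : ℤ) ^ s).toNat = 3 ^ s by exact_mod_cast Int.toNat_natCast (3 ^ s)]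
    exact Nat.log_pow (by norm_num) s
  simp [tick, this]

theorem tick_eq_none (f : J → Y → Option Y) (ty : ℕ → J × Bool) (i : J) (m : ℤ) (y : Y)
    (h : ∀ s : ℕ, m = 3 ^ s → (ty s).1 ≠ i) : tick f ty i m y = none := by
  rw [tick, if_neg]
  exact fun h' => h _ h'.1 h'.2

/-- Basis of the module with one endomorphism: powers of the endomorphism on the original basis,
and for each partial function and basis element a two-sided sequence. -/
abbrev Chain (Y J : Type*) : Type _ := (Y × ℕ) ⊕ (J × Y × ℤ)

variable {R : Type*} [Ring R] {N : Type*} [AddCommGroup N] [Module R N]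
  {N' : Type*} [AddCommGroup N'] [Module R N']
  (f f' : J → Y → Option Y) (ty : ℕ → J × Bool)

variable (R N) in
/-- The endomorphism. -/
noncomputable def shift : (Chain Y J →₀ N) →ₗ[R] (Chain Y J →₀ N) :=
  Finsupp.lsum ℕ fun b => match b with
    | .inl (y, l) => Finsupp.lsingle (.inl (y, l + 1))
    | .inr (i, y, n) => Finsupp.lsingle (.inr (i, y, n - 1)) -
        (tick f ty i (n - 1) y).elim 0 fun z => Finsupp.lsingle (.inl (z, 0))

theorem shift_single_inl (y : Y) (l : ℕ) (a : N) :
    shift R N f ty (Finsupp.single (.inl (y, l)) a) = Finsupp.single (.inl (y, l + 1)) a := by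
  simp [shift]

theorem shift_single_inr (i : J) (y : Y) (n : ℤ) (a : N) :
    shift R N f ty (Finsupp.single (.inr (i, y, n)) a) = Finsupp.single (.inr (i, y, n - 1)) a -
      (tick f ty i (n - 1) y).elim 0 fun z => Finsupp.single (.inl (z, 0)) a := by
  rw [shift, Finsupp.lsum_single]
  cases h : tick f ty i (n - 1) y <;> simp [h]

/-- Naturality in the coefficients: the endomorphism over `R ⧸ K` lifts the one over the simple
quotient, as the central-pair construction requires. -/
theorem mapRange_shift (φ : N →ₗ[R] N') (v : Chain Y J →₀ N) :
    Finsupp.mapRange.linearMap φ (shift R N f ty v) =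
      shift R N' f ty (Finsupp.mapRange.linearMap φ v) := by
  induction v using Finsupp.induction_linear with
  | zero => simp
  | add v w hv hw => simp only [map_add, hv, hw]
  | single b a =>
    rcases b with ⟨y, l⟩ | ⟨i, y, n⟩
    · simp [shift_single_inl]
    · simp only [shift_single_inr, map_sub, Finsupp.mapRange.linearMap_apply,
        Finsupp.mapRange_single]
      cases tick f ty i (n - 1) y <;> simp

variable (R N) in
/-- The expansion of an element as a power series in the endomorphism. -/
noncomputable def series (r : ℕ) : (Chain Y J →₀ N) →ₗ[R] (Y →₀ N) :=
  Finsupp.lsum ℕ fun b => match b with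
    | .inl (y, l) => if r = l then Finsupp.lsingle y else 0
    | .inr (i, y, n) => (tick f ty i (r + n) y).elim 0 Finsupp.lsingle

theorem series_single_inl (r : ℕ) (y : Y) (l : ℕ) (a : N) :
    series R N f ty r (Finsupp.single (.inl (y, l)) a) = if r = l then Finsupp.single y a else 0 := by
  rw [series, Finsupp.lsum_single]
  by_cases h : r = l <;> simp [h]

theorem series_single_inr (r : ℕ) (i : J) (y : Y) (n : ℤ) (a : N) :
    series R N f ty r (Finsupp.single (.inr (i, y, n)) a) =
      (tick f ty i (r + n) y).elim 0 fun z => Finsupp.single z a := by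
  rw [series, Finsupp.lsum_single]
  cases h : tick f ty i (r + n) y <;> simp [h]

variable (R N J) in
/-- The inclusion of constant series. -/
noncomputable def constSeries : (Y →₀ N) →ₗ[R] (Chain Y J →₀ N) :=
  partialAct R N fun y => some (.inl (y, 0))

theorem constSeries_single (y : Y) (a : N) :
    constSeries J R N (Finsupp.single y a) = Finsupp.single (.inl (y, 0)) a :=
  partialAct_single_some (f := fun y => some (Sum.inl (y, 0))) rfl a

theorem series_constSeries_zero (v : Y →₀ N) : series R N f ty 0 (constSeries J R N v) = v := by
  induction v using Finsupp.induction_linear with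
  | zero => simp
  | add v w hv hw => simp only [map_add, hv, hw]
  | single y a => simp [constSeries_single, series_single_inl]

theorem series_constSeries_succ (v : Y →₀ N) (r : ℕ) :
    series R N f ty (r + 1) (constSeries J R N v) = 0 := by
  induction v using Finsupp.induction_linear with
  | zero => simp
  | add v w hv hw => simp only [map_add, hv, hw, add_zero]
  | single y a => simp [constSeries_single, series_single_inl]

theorem series_shift_zero (w : Chain Y J →₀ N) : series R N f ty 0 (shift R N f ty w) = 0 := by
  induction w using Finsupp.induction_linear with
  | zero => simp
  | add v w hv hw => simp only [map_add, hv, hw, add_zero]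
  | single b a =>
    rcases b with ⟨y, l⟩ | ⟨i, y, n⟩
    · simp [shift_single_inl, series_single_inl]
    · rw [shift_single_inr, map_sub, series_single_inr, Nat.cast_zero, zero_add]
      cases tick f ty i (n - 1) y <;> simp [series_single_inl]

/-- The endomorphism is multiplication by X on expansions: its definition on the two-sided sequences
is the recursion e_n = tick_n + X e_(n+1). -/
theorem series_shift_succ (w : Chain Y J →₀ N) (r : ℕ) :
    series R N f ty (r + 1) (shift R N f ty w) = series R N f ty r w := by
  induction w using Finsupp.induction_linear with
  | zero => simp
  | add v w hv hw => simp only [map_add, hv, hw]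
  | single b a =>
    rcases b with ⟨y, l⟩ | ⟨i, y, n⟩
    · simp [shift_single_inl, series_single_inl]
    · rw [shift_single_inr, map_sub, series_single_inr, series_single_inr,
        show (((r + 1 : ℕ) : ℤ) + (n - 1)) = r + n by push_cast; ring]
      cases tick f ty i (n - 1) y <;> simp [series_single_inl]

theorem exists_eq_constSeries_add_shift (w : Chain Y J →₀ N) :
    ∃ w', w = constSeries J R N (series R N f ty 0 w) + shift R N f ty w' := by
  induction w using Finsupp.induction_linear with
  | zero => exact ⟨0, by simp⟩
  | add v w hv hw =>
    obtain ⟨v', hv⟩ := hv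
    obtain ⟨w', hw⟩ := hw
    refine ⟨v' + w', ?_⟩
    conv_lhs => rw [hv, hw]
    simp only [map_add]
    abel
  | single b a =>
    rcases b with ⟨y, _ | l⟩ | ⟨i, y, n⟩
    · exact ⟨0, by simp [series_single_inl, constSeries_single]⟩
    · exact ⟨Finsupp.single (.inl (y, l)) a, by simp [series_single_inl, shift_single_inl]⟩
    · refine ⟨Finsupp.single (.inr (i, y, n + 1)) a, ?_⟩
      rw [shift_single_inr, series_single_inr, Nat.cast_zero, zero_add, add_sub_cancel_right]
      cases tick f ty i n y <;> simp [constSeries_single]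

section Commute

variable (θ : (Chain Y J →₀ N) →ₗ[R] (Chain Y J →₀ N))
  (hθ : ∀ w, θ (shift R N f ty w) = shift R N f' ty (θ w))

include hθ

/-- A map commuting with X is computed by convolution: peel off the constant term of `w`, move X
through `θ`, and induct. -/
theorem series_apply_eq_sum (w : Chain Y J →₀ N) (r : ℕ) :
    series R N f' ty r (θ w) = ∑ m ∈ Finset.range (r + 1),
      series R N f' ty (r - m) (θ (constSeries J R N (series R N f ty m w))) := by
  induction r generalizing w with
  | zero =>
    obtain ⟨w', hw'⟩ := exists_eq_constSeries_add_shift (R := R) f ty w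
    conv_lhs => rw [hw', map_add, hθ, map_add, series_shift_zero, add_zero]
    simp
  | succ r ih =>
    obtain ⟨w', hw'⟩ := exists_eq_constSeries_add_shift (R := R) f ty w
    have h1 : ∀ m, series R N f ty (m + 1) w = series R N f ty m w' := fun m => by
      conv_lhs => rw [hw']
      rw [map_add, series_constSeries_succ, zero_add, series_shift_succ]
    conv_lhs => rw [hw', map_add, hθ, map_add, series_shift_succ, ih]
    rw [Finset.sum_range_succ' _ (r + 1), add_comm]
    simp only [h1, Nat.add_sub_add_right, Nat.sub_zero]

end Commute

/-- With n ≤ 3^(s-1) and |k| < s, the number 3^s - n + k lies strictly between 3^(s-1) and 3^(s+1).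
Base 2 would leave no room for a negative k. -/
theorem Int.eq_of_pow_three_near {s s' n : ℕ} {k : ℤ} (hk : k.natAbs < s) (hn : 3 * n ≤ 3 ^ s)
    (h : ((3 ^ s - n : ℕ) : ℤ) + k = 3 ^ s') : s' = s := by
  obtain ⟨t, rfl⟩ : ∃ t, s = t + 1 := ⟨s - 1, by omega⟩
  have h3 : t < 3 ^ t := Nat.lt_pow_self (by norm_num)
  have e : (3 : ℕ) ^ (t + 1) = 3 * 3 ^ t := by ring
  have h' : ((3 ^ (t + 1) - n : ℕ) : ℤ) + k = ((3 ^ s' : ℕ) : ℤ) := by push_cast; exact h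
  rcases lt_trichotomy s' (t + 1) with hlt | heq | hgt
  · have : 3 ^ s' ≤ 3 ^ t := Nat.pow_le_pow_right (by norm_num) (by omega)
    omega
  · exact heq
  · have h5 : 3 ^ (t + 1 + 1) ≤ 3 ^ s' := Nat.pow_le_pow_right (by norm_num) (by omega)
    have e2 : (3 : ℕ) ^ (t + 1 + 1) = 9 * 3 ^ t := by ring
    omega

/-- Far out, the coefficients shortly before the index `3 ^ s` lie in the range of the `s`-th
partial function, and are controlled by finitely many vectors. -/
theorem exists_tail (w : Chain Y J →₀ N) : ∃ (C : ℕ) (u : J → ℕ → (Y →₀ N)),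
    (∀ i n, C < n → u i n = 0) ∧ ∀ s ≥ C, ∀ n, 3 * n ≤ 3 ^ s →
      series R N f ty (3 ^ s - n) w = partialAct R N (stepFn f ty s) (u (ty s).1 n) := by
  classical
  induction w using Finsupp.induction_linear with
  | zero => exact ⟨0, 0, by simp, by simp⟩
  | add v w hv hw =>
    obtain ⟨C, u, hu, h⟩ := hv
    obtain ⟨C', u', hu', h'⟩ := hw
    refine ⟨max C C', u + u', fun i n hn => ?_, fun s hs n hn => ?_⟩
    · simp [hu i n (by omega), hu' i n (by omega)]
    · rw [map_add, h s (by omega) n hn, h' s (by omega) n hn, ← map_add]; rfl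
  | single b a =>
    rcases b with ⟨y, l⟩ | ⟨i, y, k⟩
    · refine ⟨l, 0, by simp, fun s hs n hn => ?_⟩
      have h3 : s < 3 ^ s := Nat.lt_pow_self (by norm_num)
      rw [series_single_inl, if_neg]
      · simp
      · rcases s with _ | s
        · simp at hn ⊢; omega
        · have e : (3 : ℕ) ^ (s + 1) = 3 * 3 ^ s := by ring
          have h3 : s < 3 ^ s := Nat.lt_pow_self (by norm_num)
          omega
    -- The coefficient at index 3^s - n is the tick at 3^s - n + k, which far out is a power of
    -- three only when n = k.
    · refine ⟨k.natAbs + 1, fun i' n => if i' = i ∧ (n : ℤ) = k then Finsupp.single y a else 0,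
        fun i' n hn => if_neg (by omega), fun s hs n hn => ?_⟩
      rw [series_single_inr]
      have hle : n ≤ 3 ^ s := by omega
      by_cases hnk : (n : ℤ) = k
      · subst hnk
        rw [show ((3 ^ s - n : ℕ) : ℤ) + n = 3 ^ s by push_cast [hle]; ring, tick_pow]
        by_cases hi : (ty s).1 = i
        · simp [hi, partialAct_single]
        · simp [hi]
      · rw [tick_eq_none]
        · simp [hnk]
        · intro s' hs'
          have := Int.eq_of_pow_three_near (by omega) hn hs'
          subst this
          push_cast [hle] at hs'
          omega

/-- An isomorphism commuting with the endomorphisms induces one commuting with all of the partial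
functions. -/
theorem exists_commute_of_commute_shift (hty : ∀ p C, ∃ s ≥ C, ty s = p)
    (θ : (Chain Y J →₀ N) ≃ₗ[R] (Chain Y J →₀ N))
    (hθ : ∀ w, θ (shift R N f ty w) = shift R N f' ty (θ w)) :
    ∃ θ₀ : (Y →₀ N) ≃ₗ[R] (Y →₀ N), ∀ i v,
      θ₀ (partialAct R N (f i) v) = partialAct R N (f' i) (θ₀ v) := by
  classical
  have hθ' : ∀ w, θ.symm (shift R N f' ty w) = shift R N f ty (θ.symm w) := fun w => by
    rw [LinearEquiv.symm_apply_eq, hθ, LinearEquiv.apply_symm_apply]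
  have h0 : ∀ (g g' : J → Y → Option Y) (φ : (Chain Y J →₀ N) ≃ₗ[R] (Chain Y J →₀ N)),
      (∀ w, φ (shift R N g ty w) = shift R N g' ty (φ w)) → ∀ w, series R N g' ty 0 (φ w) =
        series R N g' ty 0 (φ (constSeries J R N (series R N g ty 0 w))) := fun g g' φ hφ w => by
    simpa using series_apply_eq_sum g g' ty φ.toLinearMap hφ w 0
  -- By `h0` the constant term of an image depends only on the constant term of the argument, so
  -- reduction modulo X is invertible.
  let θ₀ : (Y →₀ N) ≃ₗ[R] (Y →₀ N) := LinearEquiv.ofLinearMap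
    ((series R N f' ty 0).comp (θ.toLinearMap.comp (constSeries J R N)))
    ((series R N f ty 0).comp (θ.symm.toLinearMap.comp (constSeries J R N)))
    (LinearMap.ext fun v => by
      simp only [LinearMap.comp_apply, LinearEquiv.coe_coe, LinearMap.id_apply]
      rw [← h0 f f' θ hθ, LinearEquiv.apply_symm_apply, series_constSeries_zero])
    (LinearMap.ext fun v => by
      simp only [LinearMap.comp_apply, LinearEquiv.coe_coe, LinearMap.id_apply]
      rw [← h0 f' f θ.symm hθ', LinearEquiv.symm_apply_apply, series_constSeries_zero])
  have hθ₀ : ∀ v, θ₀ v = series R N f' ty 0 (θ (constSeries J R N v)) := fun v => rfl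
  choose C u hu htail using fun w => exists_tail (R := R) (N := N) f' ty w
  refine ⟨θ₀, fun i v => ?_⟩
  -- The expansion of `g` has, at exponent 3^s with `(ty s).1 = i`, the coefficient `v` or the `f
  -- i`-image of `v`, and no other terms.
  let g : Chain Y J →₀ N := partialAct R N (fun y => some (.inr (i, y, 0))) v
  let a : ℕ → (Y →₀ N) := fun m => partialAct R N (tick f ty i m) v
  have ha : ∀ m, series R N f ty m g = a m := fun m => by
    simp only [g, a]
    induction v using Finsupp.induction_linear with
    | zero => simp
    | add v w hv hw => simp only [map_add, hv, hw]
    | single y x =>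
      rw [partialAct_single, Option.elim_some, series_single_inr, partialAct_single, add_zero]
  have ha1 : ∀ s : ℕ, (ty s).1 = i → a (3 ^ s) = partialAct R N (stepFn f ty s) v := by
    intro s hs
    simp only [a]
    congr 2
    funext y
    rw [Nat.cast_pow, Nat.cast_ofNat, tick_pow, if_pos hs]
  have ha2 : ∀ m, a m ≠ 0 → ∃ s : ℕ, m = 3 ^ s ∧ (ty s).1 = i := by
    intro m hm
    by_contra! h
    refine hm ?_
    simp only [a]
    rw [show tick f ty i m = fun _ => none from funext fun y =>
      tick_eq_none f ty i m y fun s hs => h s (by exact_mod_cast hs)]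
    clear * -
    induction v using Finsupp.induction_linear with
    | zero => simp
    | add v w hv hw => simp [hv, hw]
    | single y x => simp [partialAct_single]
  let T : (Y →₀ N) → (Chain Y J →₀ N) := fun x => θ (constSeries J R N x)
  -- The nonzero coefficients of `g` take at most two values, so one bound controls the tails of all
  -- their images.
  let K := max (C (θ g)) (max (C (T v)) (C (T (partialAct R N (f i) v))))
  have hK : ∀ m, a m ≠ 0 → C (T (a m)) ≤ K := by
    intro m hm
    obtain ⟨s, rfl, hs⟩ := ha2 m hm
    rw [ha1 s hs]
    by_cases hb : (ty s).2
    · rw [show stepFn f ty s = f i from funext fun y => by simp [stepFn, hb, hs]]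
      simp [K]
    · rw [show stepFn f ty s = some from funext fun y => by simp [stepFn, hb], partialAct_some]
      simp [K]
  let d : ℕ → (Y →₀ N) := fun m => if a m = 0 then 0 else u (T (a m)) i m
  -- In the convolution at exponent 3^s every term except the last lies in the range of the step map
  -- of `f'`; `z` collects their preimages and does not depend on `s`.
  let z := u (θ g) i 0 - ∑ m ∈ Finset.range (K + 1), d m
  have key : ∀ s ≥ K, (ty s).1 = i →
      θ₀ (partialAct R N (stepFn f ty s) v) = partialAct R N (stepFn f' ty s) z := by
    intro s hs hsi
    have h3 : s < 3 ^ s := Nat.lt_pow_self (by norm_num)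
    have h1 := htail (θ g) s (le_trans (le_max_left _ _) hs) 0 (by simp)
    have h2 := series_apply_eq_sum f f' ty θ.toLinearMap hθ g (3 ^ s)
    simp only [LinearEquiv.coe_coe] at h2
    rw [Nat.sub_zero, h2, Finset.sum_range_succ, Nat.sub_self, ha, ha1 s hsi, ← hθ₀, hsi] at h1
    have hterm : ∀ m ∈ Finset.range (3 ^ s), series R N f' ty (3 ^ s - m)
        (θ (constSeries J R N (series R N f ty m g))) = partialAct R N (stepFn f' ty s) (d m) := by
      intro m hm
      rw [ha]
      by_cases h : a m = 0
      · simp [h, d]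
      · obtain ⟨t, rfl, -⟩ := ha2 m h
        -- Earlier terms occur at exponents 3^t with t < s, so 3·3^t ≤ 3^s, as the tail estimate
        -- requires.
        have hts : t < s := (Nat.pow_lt_pow_iff_right (by norm_num)).1 (Finset.mem_range.1 hm)
        have := htail (T (a (3 ^ t))) s ((hK _ h).trans hs) (3 ^ t) (by
          rw [← pow_succ']; exact Nat.pow_le_pow_right (by norm_num) hts)
        simp only [d, if_neg h]
        rw [hsi] at this
        exact this
    rw [Finset.sum_congr rfl hterm, ← map_sum] at h1
    have hsum : ∑ m ∈ Finset.range (3 ^ s), d m = ∑ m ∈ Finset.range (K + 1), d m := by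
      symm
      refine Finset.sum_subset (Finset.range_subset_range.2 (by omega)) fun m _ hm => ?_
      simp only [Finset.mem_range, not_lt] at hm
      by_cases h : a m = 0
      · simp [d, h]
      · simp only [d, if_neg h]
        exact hu _ _ _ (lt_of_le_of_lt (hK m h) (by omega))
    rw [hsum] at h1
    simp only [z, map_sub]
    rw [← h1]
    abel
  -- An identity step gives θ₀ v = z; a step through `f i` then gives the desired commutation.
  obtain ⟨s, hs, hs'⟩ := hty (i, false) K
  obtain ⟨t, ht, ht'⟩ := hty (i, true) K
  have e1 := key s hs (by rw [hs'])
  have e2 := key t ht (by rw [ht'])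
  rw [show stepFn f ty s = some from funext fun y => by simp [stepFn, hs'],
    show stepFn f' ty s = some from funext fun y => by simp [stepFn, hs'],
    partialAct_some, partialAct_some] at e1
  rw [show stepFn f ty t = f i from funext fun y => by simp [stepFn, ht'],
    show stepFn f' ty t = f' i from funext fun y => by simp [stepFn, ht']] at e2
  rw [e1, e2]

/-- A permutation of the basis commuting with the partial functions commutes with the
endomorphisms. -/
theorem domLCongr_shift (τ : Equiv.Perm Y) (hτ : ∀ i y, f' i (τ y) = (f i y).map τ)
    (w : Chain Y J →₀ N) :
    Finsupp.domLCongr (R := R) (Equiv.sumCongr (Equiv.prodCongr τ (Equiv.refl ℕ))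
        (Equiv.prodCongr (Equiv.refl J) (Equiv.prodCongr τ (Equiv.refl ℤ)))) (shift R N f ty w) =
      shift R N f' ty (Finsupp.domLCongr (R := R) (Equiv.sumCongr (Equiv.prodCongr τ (Equiv.refl ℕ))
        (Equiv.prodCongr (Equiv.refl J) (Equiv.prodCongr τ (Equiv.refl ℤ)))) w) := by
  have htick : ∀ i m y, tick f' ty i m (τ y) = (tick f ty i m y).map τ := by
    intro i m y
    simp only [tick, stepFn, hτ]
    split_ifs <;> rfl
  induction w using Finsupp.induction_linear with
  | zero => simp
  | add v w hv hw => simp only [map_add, hv, hw]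
  | single b a =>
    rcases b with ⟨y, l⟩ | ⟨i, y, n⟩
    · simp [shift_single_inl]
    · rw [shift_single_inr, map_sub, Finsupp.domLCongr_single, Finsupp.domLCongr_single]
      simp only [Equiv.sumCongr_apply, Sum.map_inr, Equiv.prodCongr_apply, Prod.map,
        Equiv.refl_apply, shift_single_inr, htick]
      cases tick f ty i (n - 1) y <;> simp

end OneEndomorphism

/-! ### From an endomorphism to a module by means of two central elements -/

section CentralPair

variable {R : Type*} [Ring R]

/-- Multiplication by a central element as a linear map. -/
def centralSMul {x : R} (hx : x ∈ Subring.center R) (M : Type*) [AddCommGroup M] [Module R M] :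
    M →ₗ[R] M where
  toFun m := x • m
  map_add' := smul_add x
  map_smul' r m := by
    rw [RingHom.id_apply, smul_smul, smul_smul, Subring.mem_center_iff.1 hx]

variable {F G : Type*} [AddCommGroup F] [Module R F] [AddCommGroup G] [Module R G]

/-- A quotient map killed by `x` and `y` on which `x` and `y` act independently. -/
structure IndependentPair (x y : R) (q : F →ₗ[R] G) : Prop where
  surjective : Surjective q
  smul_eq_zero : ∀ v, q v = 0 → y • v = 0
  eq_zero_of_smul_eq : ∀ v w, x • v = y • w → q v = 0 ∧ q w = 0
  left_smul : ∀ g : G, x • g = 0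
  right_smul : ∀ g : G, y • g = 0

theorem IndependentPair.mapRange {x y : R} {q : F →ₗ[R] G} (h : IndependentPair x y q)
    (B : Type*) : IndependentPair x y (Finsupp.mapRange.linearMap (α := B) q) where
  surjective := Finsupp.mapRange_surjective _ (map_zero q) h.surjective
  smul_eq_zero v hv := Finsupp.ext fun b => h.smul_eq_zero _ <| by
    simpa using DFunLike.congr_fun hv b
  eq_zero_of_smul_eq v w e := by
    have := fun b => h.eq_zero_of_smul_eq (v b) (w b) (by simpa using DFunLike.congr_fun e b)
    exact ⟨Finsupp.ext fun b => by simpa using (this b).1,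
      Finsupp.ext fun b => by simpa using (this b).2⟩
  left_smul g := Finsupp.ext fun b => by simpa using h.left_smul (g b)
  right_smul g := Finsupp.ext fun b => by simpa using h.right_smul (g b)

/-- An isomorphism carrying the kernel of a surjection onto the kernel of another one descends to
the images. -/
theorem exists_linearEquiv_of_ker {A A' G' : Type*} [AddCommGroup A] [Module R A]
    [AddCommGroup A'] [Module R A'] [AddCommGroup G'] [Module R G'] (p : A →ₗ[R] G)
    (p' : A' →ₗ[R] G') (hp : Surjective p) (hp' : Surjective p') (α : A ≃ₗ[R] A')
    (h : ∀ a, p a = 0 ↔ p' (α a) = 0) : ∃ θ : G ≃ₗ[R] G', ∀ a, θ (p a) = p' (α a) := by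
  have hk : (LinearMap.ker p).map α.toLinearMap = LinearMap.ker p' := by
    ext b
    obtain ⟨a, rfl⟩ := α.surjective b
    simp [h]
  refine ⟨(p.quotKerEquivOfSurjective hp).symm ≪≫ₗ Submodule.Quotient.equiv _ _ α hk ≪≫ₗ
    p'.quotKerEquivOfSurjective hp', fun a => ?_⟩
  have : (p.quotKerEquivOfSurjective hp).symm (p a) = Submodule.Quotient.mk a := by
    rw [LinearEquiv.symm_apply_eq]; rfl
  simp only [LinearEquiv.trans_apply, this]
  rfl

variable {x y : R} (hx : x ∈ Subring.center R) (hy : y ∈ Subring.center R)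

/-- The submodule of relations `x v = y t v`. -/
def relations (t : F →ₗ[R] F) : Submodule R F :=
  LinearMap.range (centralSMul hx F - (centralSMul hy F).comp t)

theorem mem_relations {t : F →ₗ[R] F} {v : F} :
    v ∈ relations hx hy t ↔ ∃ w, x • w - y • t w = v :=
  Iff.rfl

theorem smul_mk_relations (t : F →ₗ[R] F) (v : F) :
    x • (Submodule.Quotient.mk v : F ⧸ relations hx hy t) = y • Submodule.Quotient.mk (t v) := by
  rw [← Submodule.Quotient.mk_smul, ← Submodule.Quotient.mk_smul, Submodule.Quotient.eq]
  exact ⟨v, rfl⟩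

variable {q : F →ₗ[R] G} {t t' : F →ₗ[R] F} {s s' : G →ₗ[R] G}

theorem IndependentPair.relations_le_ker (h : IndependentPair x y q) (t : F →ₗ[R] F) :
    relations hx hy t ≤ LinearMap.ker q := by
  rintro _ ⟨w, rfl⟩
  have : q (x • w - y • t w) = 0 := by simp [h.left_smul, h.right_smul]
  exact this

/-- If yv = xw - y·tw, then xw = y(tw + v), so independence kills both `q w` and `q (t w + v)`, and
hence `q v`. The kernel of `q` thus becomes the kernel of y in the quotient, which every isomorphism
respects. -/
theorem IndependentPair.smul_mk_eq_zero_iff (h : IndependentPair x y q) (hs : ∀ v, q (t v) = s (q v)) (v : F) :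
    y • (Submodule.Quotient.mk v : F ⧸ relations hx hy t) = 0 ↔ q v = 0 := by
  rw [← Submodule.Quotient.mk_smul, Submodule.Quotient.mk_eq_zero]
  refine ⟨fun ⟨w, hw⟩ => ?_, fun hv => by rw [h.smul_eq_zero v hv]; exact zero_mem _⟩
  change x • w - y • t w = y • v at hw
  obtain ⟨h1, h2⟩ := h.eq_zero_of_smul_eq w (t w + v) (by rw [smul_add, ← hw]; abel)
  rwa [map_add, hs, h1, map_zero, zero_add] at h2

/-- The endomorphism is recovered, modulo the radical, from the module. -/
theorem IndependentPair.exists_commute (h : IndependentPair x y q) (hs : ∀ v, q (t v) = s (q v))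
    (hs' : ∀ v, q (t' v) = s' (q v))
    (α : (F ⧸ relations hx hy t) ≃ₗ[R] (F ⧸ relations hx hy t')) :
    ∃ θ : G ≃ₗ[R] G, ∀ g, θ (s g) = s' (θ g) := by
  let p := (relations hx hy t).liftQ q (h.relations_le_ker hx hy t)
  let p' := (relations hx hy t').liftQ q (h.relations_le_ker hx hy t')
  have hp : ∀ a, y • a = 0 ↔ p a = 0 := fun a => by
    obtain ⟨v, rfl⟩ := Submodule.Quotient.mk_surjective _ a
    exact h.smul_mk_eq_zero_iff hx hy hs v
  have hp' : ∀ a, y • a = 0 ↔ p' a = 0 := fun a => by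
    obtain ⟨v, rfl⟩ := Submodule.Quotient.mk_surjective _ a
    exact h.smul_mk_eq_zero_iff hx hy hs' v
  have hsurj : Surjective p := fun g => by
    obtain ⟨v, rfl⟩ := h.surjective g
    exact ⟨Submodule.Quotient.mk v, rfl⟩
  have hsurj' : Surjective p' := fun g => by
    obtain ⟨v, rfl⟩ := h.surjective g
    exact ⟨Submodule.Quotient.mk v, rfl⟩
  obtain ⟨θ, hθ⟩ := exists_linearEquiv_of_ker p p' hsurj hsurj' α fun a => by
    rw [← hp, ← hp', ← map_smul, LinearEquiv.map_eq_zero_iff]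
  refine ⟨θ, fun g => ?_⟩
  obtain ⟨v, rfl⟩ := h.surjective g
  obtain ⟨v', hv'⟩ := Submodule.Quotient.mk_surjective _ (α (Submodule.Quotient.mk v))
  have e1 : θ (q v) = q v' := (hθ (Submodule.Quotient.mk v)).trans (by rw [← hv']; rfl)
  have e2 : θ (q (t v)) = p' (α (Submodule.Quotient.mk (t v))) := hθ (Submodule.Quotient.mk (t v))
  -- Both classes solve y·u = x·α(v), so they differ by an element killed by y and agree after
  -- projection.
  have e3 : y • (α (Submodule.Quotient.mk (t v)) - Submodule.Quotient.mk (t' v')) = 0 := by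
    rw [smul_sub, ← smul_mk_relations, hv', ← map_smul, ← map_smul, smul_mk_relations, sub_self]
  rw [hp', map_sub, sub_eq_zero] at e3
  rw [← hs, e2, e3, e1, ← hs']
  rfl

/-- A conjugacy of the endomorphisms gives an isomorphism of the modules. -/
theorem nonempty_equiv_of_commute (φ : F ≃ₗ[R] F) (hφ : ∀ v, φ (t v) = t' (φ v)) :
    Nonempty ((F ⧸ relations hx hy t) ≃ₗ[R] (F ⧸ relations hx hy t')) := by
  refine ⟨Submodule.Quotient.equiv _ _ φ ?_⟩
  ext v
  constructor
  · rintro ⟨_, ⟨w, rfl⟩, rfl⟩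
    refine ⟨φ w, ?_⟩
    change x • φ w - y • t' (φ w) = φ (x • w - y • t w)
    simp [hφ]
  · rintro ⟨w, rfl⟩
    refine ⟨_, ⟨φ.symm w, rfl⟩, ?_⟩
    change φ (x • φ.symm w - y • t (φ.symm w)) = x • w - y • t' w
    simp [hφ]

theorem IndependentPair.infinite_quotient (h : IndependentPair x y q) [Infinite G] :
    Infinite (F ⧸ relations hx hy t) :=
  Infinite.of_surjective ((relations hx hy t).liftQ q (h.relations_le_ker hx hy t)) fun g => by
    obtain ⟨v, rfl⟩ := h.surjective g
    exact ⟨Submodule.Quotient.mk v, rfl⟩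

end CentralPair

/-- Two central elements generating ideals with zero intersection, whose annihilators generate a
proper ideal, act independently over some simple module. -/
theorem exists_independentPair {R : Type*} [Ring R] {x y : R} (hx : x ∈ Subring.center R)
    (hy : y ∈ Subring.center R) (hxy : Ideal.span {x} ⊓ Ideal.span {y} = (⊥ : Ideal R))
    (hI : Ideal.torsionOf R R x ⊔ Ideal.torsionOf R R y ≠ ⊤) :
    ∃ (J K : Ideal R) (q : (R ⧸ K) →ₗ[R] (R ⧸ J)), IsSimpleModule R (R ⧸ J) ∧
      IndependentPair x y q := by
  obtain ⟨J, hJ, hIJ⟩ := Ideal.exists_le_maximal _ hI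
  have hcx := Subring.mem_center_iff.1 hx
  have hcy := Subring.mem_center_iff.1 hy
  have ann : ∀ a b : R, a * x = b * y → a ∈ J ∧ b ∈ J := by
    intro a b e
    have h0 : a * x = 0 := by
      rw [← Ideal.mem_bot, ← hxy]
      exact ⟨Ideal.mul_mem_left _ _ (Ideal.mem_span_singleton_self x),
        e ▸ Ideal.mul_mem_left _ _ (Ideal.mem_span_singleton_self y)⟩
    exact ⟨hIJ (Ideal.mem_sup_left ((Ideal.mem_torsionOf_iff x a).2 h0)),
      hIJ (Ideal.mem_sup_right ((Ideal.mem_torsionOf_iff y b).2 (e.symm.trans h0)))⟩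
  -- Applied to the commutation yx = xy, this puts x and y themselves in `J`.
  obtain ⟨hyJ, hxJ⟩ := ann y x (hcy x).symm
  let K : Ideal R := Submodule.map (LinearMap.toSpanSingleton R R x) J ⊔
    Submodule.map (LinearMap.toSpanSingleton R R y) J
  have hKJ : K ≤ J := by
    refine sup_le ?_ ?_
    · rintro _ ⟨j, -, rfl⟩
      exact J.mul_mem_left j hxJ
    · rintro _ ⟨j, -, rfl⟩
      exact J.mul_mem_left j hyJ
  have hK : ∀ a b : R, a * x - b * y ∈ K → a ∈ J ∧ b ∈ J := by
    intro a b hab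
    obtain ⟨_, ⟨j, hj, rfl⟩, _, ⟨j', hj', rfl⟩, e⟩ := Submodule.mem_sup.1 hab
    change j * x + j' * y = a * x - b * y at e
    -- Absorb the element jx + j'y of `K` into the coefficients to get an exact equality of a
    -- multiple of x and a multiple of y.
    obtain ⟨h1, h2⟩ := ann (a - j) (b + j') (by
      rw [sub_mul, add_mul, sub_eq_iff_eq_add, add_assoc, add_comm (j' * y), e]; abel)
    exact ⟨by simpa using add_mem h1 hj, by simpa using sub_mem h2 hj'⟩
  refine ⟨J, K, Submodule.factor hKJ, isSimpleModule_iff_isCoatom.2 hJ.out,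
    Submodule.factor_surjective hKJ, fun v hv => ?_, fun v w e => ?_, fun g => ?_, fun g => ?_⟩
  · obtain ⟨a, rfl⟩ := Submodule.Quotient.mk_surjective _ v
    have ha : a ∈ J := (Submodule.Quotient.mk_eq_zero J).1 hv
    rw [← Submodule.Quotient.mk_smul, Submodule.Quotient.mk_eq_zero, smul_eq_mul, ← hcy]
    exact Submodule.mem_sup_right ⟨a, ha, rfl⟩
  · obtain ⟨a, rfl⟩ := Submodule.Quotient.mk_surjective _ v
    obtain ⟨b, rfl⟩ := Submodule.Quotient.mk_surjective _ w
    rw [← Submodule.Quotient.mk_smul, ← Submodule.Quotient.mk_smul, Submodule.Quotient.eq,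
      smul_eq_mul, smul_eq_mul, ← hcx, ← hcy] at e
    exact ⟨(Submodule.Quotient.mk_eq_zero J).2 (hK a b e).1,
      (Submodule.Quotient.mk_eq_zero J).2 (hK a b e).2⟩
  · obtain ⟨a, rfl⟩ := Submodule.Quotient.mk_surjective _ g
    rw [← Submodule.Quotient.mk_smul, Submodule.Quotient.mk_eq_zero, smul_eq_mul, ← hcx]
    exact J.mul_mem_left a hxJ
  · obtain ⟨a, rfl⟩ := Submodule.Quotient.mk_surjective _ g
    rw [← Submodule.Quotient.mk_smul, Submodule.Quotient.mk_eq_zero, smul_eq_mul, ← hcy]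
    exact J.mul_mem_left a hyJ

/-! ### Structures on ℕ transported from modules -/

namespace BorelComplexity

open FirstOrder FirstOrder.Language

section Transport

variable {R : Type u} [Ring R] {A : Type*} [AddCommGroup A] [Module R A]

/-- The structure on `ℕ` transported from a module along a bijection. -/
@[reducible] def transportStr (β : ℕ ≃ A) : Str (moduleLanguage R) where
  funMap {n} (f : ModuleFunc R n) := match n, f with
    | _, .zero => fun _ => β.symm 0
    | _, .smul r => fun a => β.symm (r • β (a 0))
    | _, .add => fun a => β.symm (β (a 0) + β (a 1))
  RelMap r := r.elim

theorem realize_zeroT {α : Type} (β : ℕ ≃ A) (w : α → ℕ) :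
    let := transportStr (R := R) β
    (zeroT (R := R) (α := α)).realize w = β.symm 0 := rfl

theorem realize_addT {α : Type} (β : ℕ ≃ A) (w : α → ℕ) (s t : (moduleLanguage R).Term α) :
    let := transportStr (R := R) β
    (addT s t).realize w = β.symm (β (s.realize w) + β (t.realize w)) := rfl

theorem realize_smulT {α : Type} (β : ℕ ≃ A) (w : α → ℕ) (r : R) (t : (moduleLanguage R).Term α) :
    let := transportStr (R := R) β
    (smulT r t).realize w = β.symm (r • β (t.realize w)) := rfl

theorem transportStr_mem_models (β : ℕ ≃ A) :
    transportStr β ∈ Models (moduleTheory R) := by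
  let := transportStr (R := R) β
  refine ⟨fun φ hφ => ?_⟩
  cases hφ <;>
    simp only [Sentence.Realize, Formula.Realize, BoundedFormula.realize_all,
      BoundedFormula.realize_ex, BoundedFormula.realize_bdEqual, realize_addT, realize_zeroT,
      realize_smulT, Equiv.apply_symm_apply]
  · simp [add_assoc]
  · simp [add_comm]
  · simp
  · intro a
    refine ⟨β.symm (- β a), ?_⟩
    simp [Fin.snoc]
  · simp
  · simp [add_smul]
  · simp [mul_smul]
  · simp

theorem iso_transportStr_iff {A' : Type*} [AddCommGroup A'] [Module R A'] (β : ℕ ≃ A)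
    (β' : ℕ ≃ A') :
    Iso (transportStr (R := R) β) (transportStr β') ↔ Nonempty (A ≃ₗ[R] A') := by
  constructor
  · rintro ⟨e₀⟩
    let e : ℕ ≃ ℕ := @FirstOrder.Language.Equiv.toEquiv _ _ _ (transportStr β) (transportStr β') e₀
    have hadd : ∀ a b : ℕ, e (β.symm (β a + β b)) = β'.symm (β' (e a) + β' (e b)) := fun a b =>
      @FirstOrder.Language.Equiv.map_fun' _ _ _ (transportStr β) (transportStr β') e₀ 2
        (ModuleFunc.add : ModuleFunc R 2) ![a, b]
    have hsmul : ∀ (r : R) (a : ℕ), e (β.symm (r • β a)) = β'.symm (r • β' (e a)) := fun r a =>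
      @FirstOrder.Language.Equiv.map_fun' _ _ _ (transportStr β) (transportStr β') e₀ 1
        (ModuleFunc.smul r : ModuleFunc R 1) ![a]
    refine ⟨{ (β.symm.trans e).trans β' with
      map_add' := fun a b => ?_
      map_smul' := fun r a => ?_ }⟩
    · have := hadd (β.symm a) (β.symm b)
      simp only [Equiv.apply_symm_apply] at this
      change β' (e (β.symm (a + b))) = β' (e (β.symm a)) + β' (e (β.symm b))
      rw [this, Equiv.apply_symm_apply]
    · have := hsmul r (β.symm a)
      simp only [Equiv.apply_symm_apply] at this
      change β' (e (β.symm (r • a))) = r • β' (e (β.symm a))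
      rw [this, Equiv.apply_symm_apply]
  · rintro ⟨φ⟩
    refine ⟨@FirstOrder.Language.Equiv.mk _ _ _ (transportStr β) (transportStr β')
      ((β.trans φ.toEquiv).trans β'.symm) (fun {n} f a => ?_) (fun {n} r _ => r.elim)⟩
    cases f with
    | zero =>
      change β'.symm (φ (β (β.symm 0))) = β'.symm 0
      simp
    | smul r =>
      change β'.symm (φ (β (β.symm (r • β (a 0))))) = β'.symm (r • β' (β'.symm (φ (β (a 0)))))
      simp
    | add =>
      change β'.symm (φ (β (β.symm (β (a 0) + β (a 1))))) =
        β'.symm (β' (β'.symm (φ (β (a 0)))) + β' (β'.symm (φ (β (a 1)))))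
      simp

end Transport

/-! ### Borel dependence of a quotient on its submodule -/

section Measurable

/-- With countably many symbols the defining subbasis is countable, so it generates the Borel
σ-algebra. -/
theorem measurable_str {Ω : Type*} [MeasurableSpace Ω] {L : FirstOrder.Language}
    [∀ n, Countable (L.Functions n)] [∀ n, IsEmpty (L.Relations n)] {f : Ω → Str L}
    (h : ∀ (n : ℕ) (s : L.Functions n) a b, MeasurableSet {ω | (f ω).funMap s a = b}) :
    Measurable f := by
  let B : Set (Set (Str L)) := Set.range fun p : Σ n, L.Functions n × (Fin n → ℕ) × ℕ =>
    {M : Str L | M.funMap p.2.1 p.2.2.1 = p.2.2.2}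
  have hB : instTopologicalSpaceStr L = TopologicalSpace.generateFrom B := by
    unfold instTopologicalSpaceStr
    congr 1
    ext U
    constructor
    · rintro ((⟨n, s, a, b, rfl⟩ | ⟨n, r, -⟩) | ⟨n, r, -⟩)
      · exact ⟨⟨n, s, a, b⟩, rfl⟩
      · exact isEmptyElim r
      · exact isEmptyElim r
    · rintro ⟨⟨n, s, a, b⟩, rfl⟩
      exact Or.inl (Or.inl ⟨n, s, a, b, rfl⟩)
  have hc : B.Countable := Set.countable_range _
  have : SecondCountableTopology (Str L) := ⟨B, hc, hB⟩
  have hm : instMeasurableSpaceStr L = MeasurableSpace.generateFrom B :=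
    borel_eq_generateFrom_of_subbasis hB
  rw [hm]
  refine measurable_generateFrom ?_
  rintro _ ⟨⟨n, s, a, b⟩, rfl⟩
  exact h n s a b

variable {R : Type u} [Ring R] {Ω : Type*} [MeasurableSpace Ω]
  {F : Type*} [AddCommGroup F] [Module R F]

/-- The index `n` is the least one of its class. -/
def IsLeastIndex (e : ℕ → F) (K : Submodule R F) (n : ℕ) : Prop := ∀ m < n, e n - e m ∉ K

theorem exists_isLeastIndex (e : ℕ → F) (he : Surjective e) (K : Submodule R F) (v : F ⧸ K) :
    ∃ n, IsLeastIndex e K n ∧ Submodule.Quotient.mk (e n) = v := by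
  classical
  have h : ∃ n, Submodule.Quotient.mk (e n) = v := by
    obtain ⟨w, rfl⟩ := Submodule.Quotient.mk_surjective _ v
    obtain ⟨n, rfl⟩ := he w
    exact ⟨n, rfl⟩
  refine ⟨Nat.find h, fun m hm hK => ?_, Nat.find_spec h⟩
  exact Nat.find_min h hm (((Submodule.Quotient.eq K).2 hK).symm.trans (Nat.find_spec h))

theorem IsLeastIndex.eq {e : ℕ → F} {K : Submodule R F} {n m : ℕ} (hn : IsLeastIndex e K n)
    (hm : IsLeastIndex e K m)
    (h : (Submodule.Quotient.mk (e n) : F ⧸ K) = Submodule.Quotient.mk (e m)) : n = m := by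
  rcases lt_trichotomy n m with hlt | rfl | hlt
  · exact (hm n hlt ((Submodule.Quotient.eq K).1 h.symm)).elim
  · rfl
  · exact (hn m hlt ((Submodule.Quotient.eq K).1 h)).elim

theorem infinite_isLeastIndex (e : ℕ → F) (he : Surjective e) (K : Submodule R F)
    [Infinite (F ⧸ K)] : {n | IsLeastIndex e K n}.Infinite := by
  rw [← Set.infinite_coe_iff]
  refine Infinite.of_surjective
    (fun n : {n | IsLeastIndex e K n} => (Submodule.Quotient.mk (e n) : F ⧸ K)) fun v => ?_
  obtain ⟨n, hn, rfl⟩ := exists_isLeastIndex e he K v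
  exact ⟨⟨n, hn⟩, rfl⟩

/-- The enumeration of an infinite quotient by least indices. -/
noncomputable def enumQuotient (e : ℕ → F) (he : Surjective e) (K : Submodule R F)
    [Infinite (F ⧸ K)] : ℕ ≃ F ⧸ K :=
  Equiv.ofBijective (fun k => Submodule.Quotient.mk (e (Nat.nth (IsLeastIndex e K) k))) <| by
    classical
    have hinf := infinite_isLeastIndex e he K
    constructor
    · intro k l h
      exact Nat.nth_injective hinf
        ((Nat.nth_mem_of_infinite hinf k).eq (Nat.nth_mem_of_infinite hinf l) h)
    · intro v
      obtain ⟨n, hn, rfl⟩ := exists_isLeastIndex e he K v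
      exact ⟨Nat.count (IsLeastIndex e K) n, congrArg (fun m => Submodule.Quotient.mk (e m)) (Nat.nth_count hn)⟩

/-- The `k`-th member is `n` exactly when `n` is a member and precisely `k` members precede it;
finite counts are measurable. -/
theorem measurableSet_nth {p : Ω → ℕ → Prop} (hp : ∀ n, MeasurableSet {ω | p ω n})
    (hinf : ∀ ω, {n | p ω n}.Infinite) (k n : ℕ) : MeasurableSet {ω | Nat.nth (p ω) k = n} := by
  classical
  have hcount : ∀ n, Measurable fun ω => Nat.count (p ω) n := fun n => by
    induction n with
    | zero => simp
    | succ n ih =>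
      simp only [Nat.count_succ]
      exact ih.add (Measurable.ite (hp n) measurable_const measurable_const)
  have : {ω | Nat.nth (p ω) k = n} = {ω | p ω n} ∩ {ω | Nat.count (p ω) n = k} := by
    ext ω
    constructor
    · rintro rfl
      exact ⟨Nat.nth_mem_of_infinite (hinf ω) k, Nat.count_nth_of_infinite (hinf ω) k⟩
    · rintro ⟨h, rfl⟩
      exact Nat.nth_count h
  rw [this]
  exact (hp n).inter (hcount n (measurableSet_singleton k))

/-- A measurable family of submodules with infinite quotients gives a measurable family of
structures isomorphic to the quotients. -/
theorem exists_measurable_models [Countable R] [Countable F] (K : Ω → Submodule R F)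
    (hK : ∀ v, MeasurableSet {ω | v ∈ K ω}) (hinf : ∀ ω, Infinite (F ⧸ K ω)) :
    ∃ f : Ω → Models (moduleTheory R), Measurable f ∧
      ∀ ω ω', Iso (f ω).1 (f ω').1 ↔ Nonempty ((F ⧸ K ω) ≃ₗ[R] (F ⧸ K ω')) := by
  obtain ⟨e, he⟩ := exists_surjective_nat F
  let β := fun ω => enumQuotient e he (K ω)
  refine ⟨fun ω => ⟨transportStr (β ω), transportStr_mem_models _⟩, ?_, fun ω ω' =>
    iso_transportStr_iff _ _⟩
  refine Measurable.subtype_mk ?_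
  have : ∀ n, Countable ((moduleLanguage R).Functions n) := fun n => by
    refine Injective.countable (f := fun s : ModuleFunc R n =>
      match n, s with | _, .zero => (none : Option R) | _, .smul r => some r | _, .add => none) ?_
    intro s t h
    cases s <;> cases t <;> simp_all <;> rfl
  have : ∀ n, IsEmpty ((moduleLanguage R).Relations n) := fun n => inferInstanceAs (IsEmpty Empty)
  let σ : Ω → ℕ → F := fun ω k => e (Nat.nth (IsLeastIndex e (K ω)) k)
  have hβ : ∀ ω k, β ω k = Submodule.Quotient.mk (σ ω k) := fun ω k => rfl
  let : MeasurableSpace F := ⊤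
  have : DiscreteMeasurableSpace F := ⟨fun _ => trivial⟩
  have hleast : ∀ n, MeasurableSet {ω | IsLeastIndex e (K ω) n} := fun n => by
    simp only [IsLeastIndex, Set.ofPred_forall]
    exact MeasurableSet.iInter fun m => MeasurableSet.iInter fun _ => (hK _).compl
  have hσ : ∀ k, Measurable fun ω => σ ω k := fun k => by
    have h1 : Measurable fun ω => Nat.nth (IsLeastIndex e (K ω)) k :=
      measurable_to_countable' fun n =>
        measurableSet_nth hleast (fun ω => infinite_isLeastIndex e he (K ω)) k n
    exact measurable_from_top.comp h1
  have hmem : ∀ s : Ω → F, Measurable s → MeasurableSet {ω | s ω ∈ K ω} := fun s hs => by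
    have : {ω | s ω ∈ K ω} = ⋃ v, {ω | s ω = v} ∩ {ω | v ∈ K ω} := by
      ext ω; simp
    rw [this]
    exact MeasurableSet.iUnion fun v => (hs (measurableSet_singleton v)).inter (hK v)
  -- An operation has value `b` exactly when the difference of two measurable representatives lies
  -- in the submodule.
  have hop : ∀ {s : Ω → F}, Measurable s → ∀ b, MeasurableSet
      {ω | (β ω).symm (Submodule.Quotient.mk (s ω)) = b} := fun {s} hs b => by
    simp only [Equiv.symm_apply_eq, hβ, Submodule.Quotient.eq]
    exact hmem _ ((Measurable.of_discrete (f := fun p : F × F => p.1 - p.2)).comp (hs.prodMk (hσ b)))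
  refine measurable_str fun n (s : ModuleFunc R n) a b => ?_
  cases s with
  | zero => exact hop (s := fun _ => 0) measurable_const b
  | smul r =>
    exact hop (s := fun ω => r • σ ω (a 0)) (measurable_from_top.comp (hσ _)) b
  | add =>
    exact hop (s := fun ω => σ ω (a 0) + σ ω (a 1))
      ((Measurable.of_discrete (f := fun p : F × F => p.1 + p.2)).comp ((hσ _).prodMk (hσ _))) b

end Measurable

end BorelComplexity

/-! ### Countability and measurability of the coding -/

instance {Γ : Type*} [Countable Γ] : Countable (Vertex Γ) := by
  refine Injective.countable (f := fun y : Vertex Γ => match y with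
    | .pt a => (.inl a : Pt ⊕ (ℕ × Γ) ⊕ (ℕ × ℕ) ⊕ ℕ)
    | .tors n g => .inr (.inl (n, g))
    | .val n w => .inr (.inr (.inl (n, w)))
    | .elt m => .inr (.inr (.inr m))) ?_
  intro a b h
  cases a <;> cases b <;> simp_all

instance {Γ S : Type*} [Countable Γ] [Countable S] : Countable (Op Γ S) := by
  refine Injective.countable (f := fun o : Op Γ S => match o with
    | .pts => (.inl true : Bool ⊕ ℕ ⊕ Γ ⊕ ℕ ⊕ ℕ ⊕ S)
    | .orbit => .inl false
    | .block n => .inr (.inl n)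
    | .mulRight γ => .inr (.inr (.inl γ))
    | .eval n => .inr (.inr (.inr (.inl n)))
    | .coord i => .inr (.inr (.inr (.inr (.inl i))))
    | .pred j => .inr (.inr (.inr (.inr (.inr j))))) ?_
  intro a b h
  cases a <;> cases b <;> simp_all

/-- Unpairing repeats every value cofinally, so both kinds of step recur for each partial function.
-/
theorem exists_recurrent (α : Type*) [Countable α] [Nonempty α] :
    ∃ ty : ℕ → α, ∀ p C, ∃ s ≥ C, ty s = p := by
  obtain ⟨g, hg⟩ := exists_surjective_nat α
  refine ⟨fun n => g n.unpair.1, fun p C => ?_⟩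
  obtain ⟨k, rfl⟩ := hg p
  exact ⟨Nat.pair k C, Nat.right_le_pair k C, by simp⟩

section Measurable

variable {Ω : Type*} [MeasurableSpace Ω]

theorem measurable_op_fn {Γ S : Type*} [Group Γ] [MulAction Γ ℕ]
    [MeasurableSpace (Option (Vertex Γ))] {P : Ω → S → Set (List ℕ)}
    (hP : ∀ j l, MeasurableSet {ω | l ∈ P ω j}) (o : Op Γ S) (y : Vertex Γ) :
    Measurable fun ω => o.fn (P ω) y := by
  classical
  cases o <;> cases y <;> try exact measurable_const
  rename_i j a
  exact Measurable.ite (hP j a.1) measurable_const measurable_const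

theorem measurable_shift_apply {R : Type*} [Ring R] {N : Type*} [AddCommGroup N] [Module R N]
    {Y J : Type*} [Countable Y] [Countable J] [Countable N]
    [MeasurableSpace (Option Y)] [DiscreteMeasurableSpace (Option Y)]
    [MeasurableSpace (Chain Y J →₀ N)] [DiscreteMeasurableSpace (Chain Y J →₀ N)]
    {f : Ω → J → Y → Option Y} (hf : ∀ i y, Measurable fun ω => f ω i y) (ty : ℕ → J × Bool)
    (v : Chain Y J →₀ N) : Measurable fun ω => shift R N (f ω) ty v := by
  induction v using Finsupp.induction_linear with
  | zero => simp
  | add v w hv hw =>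
    simp only [map_add]
    exact (Measurable.of_discrete (f := fun p : (Chain Y J →₀ N) × (Chain Y J →₀ N) =>
      p.1 + p.2)).comp (hv.prodMk hw)
  | single b a =>
    rcases b with ⟨y, l⟩ | ⟨i, y, n⟩
    · simp only [shift_single_inl]
      exact measurable_const
    · simp only [shift_single_inr]
      have h : Measurable fun ω => tick (f ω) ty i (n - 1) y := by
        unfold tick stepFn
        split_ifs
        · exact hf _ _
        · exact measurable_const
        · exact measurable_const
      exact (Measurable.of_discrete (f := fun o : Option Y =>
        (Finsupp.single (.inr (i, y, n - 1)) a : Chain Y J →₀ N) -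
          o.elim 0 fun z => Finsupp.single (.inl (z, 0)) a)).comp h

theorem measurableSet_mem_relations {R : Type*} [Ring R] {x y : R} (hx : x ∈ Subring.center R)
    (hy : y ∈ Subring.center R) {F : Type*} [AddCommGroup F] [Module R F] [Countable F]
    [MeasurableSpace F] [DiscreteMeasurableSpace F] {t : Ω → F →ₗ[R] F}
    (ht : ∀ w, Measurable fun ω => t ω w) (v : F) :
    MeasurableSet {ω | v ∈ relations hx hy (t ω)} := by
  simp only [mem_relations, Set.ofPred_exists]
  exact MeasurableSet.iUnion fun w => (Measurable.of_discrete (f := fun u => x • w - y • u)).comp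
    (ht w) (measurableSet_singleton v)

end Measurable

namespace BorelComplexity

open FirstOrder FirstOrder.Language

/-! ### Structures as families of sets of lists -/

section SymbolGraph

variable {L : FirstOrder.Language.{u, v}}

/-- The graphs of the function symbols and the relations of a structure, as sets of lists. -/
def symbolGraph (M : Str L) : L.Symbols → Set (List ℕ)
  | .inl ⟨n, f⟩ => {l | ∃ a : Fin n → ℕ, l = M.funMap f a :: List.ofFn a}
  | .inr ⟨n, r⟩ => {l | ∃ a : Fin n → ℕ, l = List.ofFn a ∧ M.RelMap r a}

theorem map_mem_symbolGraph {M N : Str L} (e : @FirstOrder.Language.Equiv L ℕ ℕ M N)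
    (j : L.Symbols) {l : List ℕ} (hl : l ∈ symbolGraph M j) :
    l.map (@FirstOrder.Language.Equiv.toEquiv L ℕ ℕ M N e) ∈ symbolGraph N j := by
  rcases j with ⟨n, f⟩ | ⟨n, r⟩
  · obtain ⟨a, rfl⟩ := hl
    refine ⟨@FirstOrder.Language.Equiv.toEquiv L ℕ ℕ M N e ∘ a, ?_⟩
    rw [List.map_cons, List.map_ofFn]
    exact congrArg (· :: _) (@FirstOrder.Language.Equiv.map_fun' L ℕ ℕ M N e n f a)
  · obtain ⟨a, rfl, ha⟩ := hl
    exact ⟨_ ∘ a, List.map_ofFn, (@FirstOrder.Language.Equiv.map_rel' L ℕ ℕ M N e n r a).2 ha⟩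

/-- Each function value heads the list of its arguments, so preserving graphs in one direction
already forces preservation of values. -/
theorem iso_iff_exists_perm {M N : Str L} :
    Iso M N ↔ ∃ π : Equiv.Perm ℕ, ∀ j l, l ∈ symbolGraph M j ↔ l.map π ∈ symbolGraph N j := by
  constructor
  · rintro ⟨e⟩
    refine ⟨@FirstOrder.Language.Equiv.toEquiv L ℕ ℕ M N e, fun j l =>
      ⟨map_mem_symbolGraph e j, fun h => ?_⟩⟩
    have := map_mem_symbolGraph (@FirstOrder.Language.Equiv.symm L ℕ ℕ M N e) j h
    rw [List.map_map] at this
    convert this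
    conv_lhs => rw [← List.map_id l]
    congr 1
    funext a
    exact ((@FirstOrder.Language.Equiv.toEquiv L ℕ ℕ M N e).symm_apply_apply a).symm
  · rintro ⟨π, hπ⟩
    refine ⟨@FirstOrder.Language.Equiv.mk L ℕ ℕ M N π (fun {n} f a => ?_) (fun {n} r a => ?_)⟩
    · obtain ⟨b, hb⟩ := (hπ (.inl ⟨n, f⟩) _).1 ⟨a, rfl⟩
      rw [List.map_cons, List.map_ofFn, List.cons.injEq] at hb
      exact hb.1.trans (congrArg _ (List.ofFn_injective hb.2).symm)
    · constructor
      · intro h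
        obtain ⟨b, hb, hb'⟩ := (hπ (.inr ⟨n, r⟩) (List.ofFn a)).2
          ⟨π ∘ a, List.map_ofFn, h⟩
        rwa [List.ofFn_injective hb]
      · intro h
        obtain ⟨b, hb, hb'⟩ := (hπ (.inr ⟨n, r⟩) (List.ofFn a)).1 ⟨a, rfl, h⟩
        rw [List.map_ofFn] at hb
        exact (List.ofFn_injective hb).symm ▸ hb'

theorem measurableSet_mem_symbolGraph (j : L.Symbols) (l : List ℕ) :
    MeasurableSet {M : Str L | l ∈ symbolGraph M j} := by
  refine IsOpen.measurableSet ?_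
  rcases j with ⟨n, f⟩ | ⟨n, r⟩
  · have : {M : Str L | l ∈ symbolGraph M (.inl ⟨n, f⟩)} =
        ⋃ (a : Fin n → ℕ) (b : ℕ) (_ : l = b :: List.ofFn a), {M : Str L | M.funMap f a = b} := by
      ext M
      simp [symbolGraph]
    rw [this]
    exact isOpen_iUnion fun a => isOpen_iUnion fun b => isOpen_iUnion fun _ =>
      TopologicalSpace.isOpen_generateFrom_of_mem (Or.inl (Or.inl ⟨n, f, a, b, rfl⟩))
  · have : {M : Str L | l ∈ symbolGraph M (.inr ⟨n, r⟩)} =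
        ⋃ (a : Fin n → ℕ) (_ : l = List.ofFn a), {M : Str L | M.RelMap r a} := by
      ext M
      simp [symbolGraph]
    rw [this]
    exact isOpen_iUnion fun a => isOpen_iUnion fun _ =>
      TopologicalSpace.isOpen_generateFrom_of_mem (Or.inl (Or.inr ⟨n, r, a, rfl⟩))

end SymbolGraph

end BorelComplexity

/-! ### Assembly of the reduction -/

theorem mainTheorem4 {R : Type u} [Ring R] [Countable R] (x y : R)
    (hx : x ∈ Subring.center R) (hy : y ∈ Subring.center R)
    (hxy : Ideal.span {x} ⊓ Ideal.span {y} = (⊥ : Ideal R))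
    (hI : Ideal.torsionOf R R x ⊔ Ideal.torsionOf R R y ≠ ⊤) :
    BorelComplexity.BorelComplete
      (BorelComplexity.Models (BorelComplexity.moduleTheory R)) := by
  intro L hL ψ
  obtain ⟨Γ, _, _, _, _, hΓ⟩ := exists_twoUniqueProds_highlyTransitive
  obtain ⟨J, K, q, hJ, hq⟩ := exists_independentPair hx hy hxy hI
  have : Countable (R ⧸ K) := (Submodule.Quotient.mk_surjective K).countable
  have : Nontrivial (R ⧸ J) := IsSimpleModule.nontrivial R _
  have : Nonempty (Op Γ L.Symbols) := ⟨.pts⟩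
  have : Nonempty (Vertex Γ) := ⟨.elt 0⟩
  obtain ⟨ty, hty⟩ := exists_recurrent (Op Γ L.Symbols × Bool)
  let f : BorelComplexity.Str L → Op Γ L.Symbols → Vertex Γ → Option (Vertex Γ) := fun M o =>
    o.fn (BorelComplexity.symbolGraph M)
  have hq' := hq.mapRange (Chain (Vertex Γ) (Op Γ L.Symbols))
  have hcomm : ∀ M v, Finsupp.mapRange.linearMap q (shift R (R ⧸ K) (f M) ty v) =
      shift R (R ⧸ J) (f M) ty (Finsupp.mapRange.linearMap q v) := fun M =>
    mapRange_shift (f M) ty q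
  have hmeas : ∀ v, MeasurableSet {M : BorelComplexity.InfModels ψ |
      v ∈ relations hx hy (shift R (R ⧸ K) (f M.1) ty)} := by
    let : MeasurableSpace (Option (Vertex Γ)) := ⊤
    let : MeasurableSpace (Chain (Vertex Γ) (Op Γ L.Symbols) →₀ R ⧸ K) := ⊤
    have : DiscreteMeasurableSpace (Option (Vertex Γ)) := ⟨fun _ => trivial⟩
    have : DiscreteMeasurableSpace (Chain (Vertex Γ) (Op Γ L.Symbols) →₀ R ⧸ K) :=
      ⟨fun _ => trivial⟩
    exact measurableSet_mem_relations hx hy <| measurable_shift_apply (fun o z =>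
      measurable_op_fn (fun j l => measurable_subtype_coe
        (BorelComplexity.measurableSet_mem_symbolGraph j l)) o z) ty
  obtain ⟨F, hF, hiso⟩ := BorelComplexity.exists_measurable_models _ hmeas fun M =>
    hq'.infinite_quotient hx hy
  refine ⟨F, hF, fun M N => (hiso M N).trans ?_⟩
  rw [BorelComplexity.iso_iff_exists_perm]
  constructor
  -- Decode in three stages: module to endomorphism over the simple module, endomorphism to partial
  -- functions, and partial functions to a permutation of the universe.
  · rintro ⟨α⟩
    obtain ⟨θ, hθ⟩ := hq'.exists_commute hx hy (hcomm M.1) (hcomm N.1) α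
    obtain ⟨θ₀, hθ₀⟩ := exists_commute_of_commute_shift (f M.1) (f N.1) ty hty θ hθ
    refine exists_perm_of_commute θ₀ hθ₀ fun w => ?_
    obtain ⟨γ, hγ⟩ := hΓ 1 ⟨fun _ => 0, injective_of_subsingleton _⟩
      ⟨fun _ => w, injective_of_subsingleton _⟩
    exact ⟨γ, hγ 0⟩
  · rintro ⟨π, hπ⟩
    obtain ⟨τ, hτ⟩ := exists_vertex_perm (S := L.Symbols) hΓ π hπ
    exact nonempty_equiv_of_commute hx hy _ (domLCongr_shift (f M.1) (f N.1) ty τ hτ)
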